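/- Let $m\ge 1$ be an integer, let $M=(\mathbb C\cup\{\infty\})\setminus\{z: z^{m+1}=1\}$ be the Riemann sphere punctured at the $(m+1)$-th roots of unity, and for $j=0,1,\dots,m-1$ put $$g_j(z)=\frac{z^j(1-z^{2m-2j})}{(z^{m+1}-1)^2},\qquad h_j(z)=\frac{i\,z^j(1+z^{2m-2j})}{(z^{m+1}-1)^2}.$$ Let $z_0\in M\cap\mathbb C$. Then $$f_m(z)=\operatorname{Re}\int_{z_0}^z\Bigl(g_0,h_0,g_1,h_1,\dots,g_{m-1},h_{m-1},\frac{2\sqrt m\,z^m}{(z^{m+1}-1)^2}\Bigr)\,dz$$ does not depend on the path of integration in $M\cap\mathbb C$, and it extends over $\infty$ to a conformal minimal immersion $f_m\colon M\to\mathbb R^{n}$, $n=2m+1$, with the following properties. 1. The metric induced by $f_m$ on $M$ is complete, and $f_m$ is full: $f_m(M)$ is contained in no affine hyperplane of $\mathbb R^{n}$. 2. The curvature form $K\,dA$ of the induced metric is integrable on $M$, and the total curvature is $\mathrm{TC}(M)=\int_M K\,dA=-4m\pi$. 3. The Gauss map $\nu=[\partial f_m/\partial z]\colon M\to\mathbb{CP}^{n-1}$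 is non-degenerate: $\nu(M)$ is contained in no proper projective subspace of $\mathbb{CP}^{n-1}$. 4. The surface has $k=m+1$ ends (the punctures). With $\chi_M$ the Euler number of $M$, equality holds in the Chern–Osserman inequality $\mathrm{TC}(M)\le 2\pi(\chi_M-k)$, that is, $\mathrm{TC}(M)=2\pi(\chi_M-k)$. 5. Equality holds, with $l=0$, in Ejiri's inequality $\mathrm{TC}(M)\le(\chi_M+k-2n+2l)\pi$, which is attached to a Gauss image $\nu(M)$ contained in an $(n-1-l)$-dimensional projective subspace of $\mathbb{CP}^{n-1}$; that is, $\mathrm{TC}(M)=(\chi_M+k-2n)\pi$. -/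

import Mathlib

noncomputable section

/-! ### Surfaces in Euclidean space in a complex coordinate `z = u + iv` -/

/-- The partial derivative of `F` at `z` in the direction `e`
(`e = 1` gives `∂/∂u`, `e = Complex.I` gives `∂/∂v`). -/
def partialD {n : ℕ} (F : ℂ → EuclideanSpace ℝ (Fin n)) (e z : ℂ) : EuclideanSpace ℝ (Fin n) :=
  fderiv ℝ F z e

/-- The coefficient `E = ⟨F_u, F_u⟩` of the first fundamental form. -/
def coeffE {n : ℕ} (F : ℂ → EuclideanSpace ℝ (Fin n)) (z : ℂ) : ℝ :=
  inner ℝ (partialD F 1 z) (partialD F 1 z)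

/-- The coefficient `F = ⟨F_u, F_v⟩` of the first fundamental form. -/
def coeffF {n : ℕ} (F : ℂ → EuclideanSpace ℝ (Fin n)) (z : ℂ) : ℝ :=
  inner ℝ (partialD F 1 z) (partialD F Complex.I z)

/-- The coefficient `G = ⟨F_v, F_v⟩` of the first fundamental form. -/
def coeffG {n : ℕ} (F : ℂ → EuclideanSpace ℝ (Fin n)) (z : ℂ) : ℝ :=
  inner ℝ (partialD F Complex.I z) (partialD F Complex.I z)

/-- The normal part of a vector at `z`: the orthogonal projection to the orthogonal complement of
the tangent plane spanned by `F_u` and `F_v`. -/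
def normalPart {n : ℕ} (F : ℂ → EuclideanSpace ℝ (Fin n)) (z : ℂ) (x : EuclideanSpace ℝ (Fin n)) :
    EuclideanSpace ℝ (Fin n) :=
  (Submodule.span ℝ {partialD F 1 z, partialD F Complex.I z})ᗮ.starProjection x

/-- The mean curvature vector: half the trace, with respect to the first fundamental form, of the
second fundamental form (the normal part of the second derivatives). -/
def meanCurvatureVector {n : ℕ} (F : ℂ → EuclideanSpace ℝ (Fin n)) (z : ℂ) :
    EuclideanSpace ℝ (Fin n) :=
  (2 * (coeffE F z * coeffG F z - coeffF F z ^ 2))⁻¹ •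
    normalPart F z
      (coeffG F z • partialD (partialD F 1) 1 z
        - (2 * coeffF F z) • partialD (partialD F 1) Complex.I z
        + coeffE F z • partialD (partialD F Complex.I) Complex.I z)

/-- `F` is a conformal minimal immersion of the open set `U ⊆ ℂ`: a smooth immersion whose first
fundamental form is a multiple of `du² + dv²` and whose mean curvature vector vanishes. -/
structure IsConformalMinimalOn {n : ℕ} (F : ℂ → EuclideanSpace ℝ (Fin n)) (U : Set ℂ) : Prop where
  isOpen : IsOpen U
  smooth : ContDiffOn ℝ (⊤ : ℕ∞) F U
  immersion : ∀ z ∈ U, Function.Injective (fderiv ℝ F z)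
  conformal : ∀ z ∈ U, coeffE F z = coeffG F z ∧ coeffF F z = 0
  minimal : ∀ z ∈ U, meanCurvatureVector F z = 0

/-- The Gauss curvature `K = -Δ(log λ) / (2λ)` of the metric `λ (du² + dv²)` induced by a conformal
immersion `F`, where `λ = E = G`. -/
def gaussCurvature {n : ℕ} (F : ℂ → EuclideanSpace ℝ (Fin n)) (z : ℂ) : ℝ :=
  -(Laplacian.laplacian (fun w : ℂ => Real.log (coeffE F w)) z : ℝ)
    / (2 * coeffE F z)

/-- The density `√(EG - F²)` of the area element with respect to `du dv`. -/
def areaDensity {n : ℕ} (F : ℂ → EuclideanSpace ℝ (Fin n)) (z : ℂ) : ℝ :=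
  Real.sqrt (coeffE F z * coeffG F z - coeffF F z ^ 2)

/-- The vector `∂F/∂z = (F_u - i F_v) / 2` of `ℂⁿ`. -/
def complexPartial {n : ℕ} (F : ℂ → EuclideanSpace ℝ (Fin n)) (z : ℂ) : Fin n → ℂ :=
  fun k => ((partialD F 1 z k : ℂ) - Complex.I * (partialD F Complex.I z k : ℂ)) / 2

/-! ### Surfaces parametrized by open subsets of the Riemann sphere -/

/-- The Riemann sphere `ℂ ∪ {∞}`. -/
abbrev RSphere : Type := OnePoint ℂ

/-- The parametrization of the neighbourhood `ℂ` of `0` by the coordinate `z`. -/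
def paramZero : ℂ → RSphere := fun z => (z : OnePoint ℂ)

/-- The parametrization of the neighbourhood `(ℂ ∖ {0}) ∪ {∞}` of `∞` by the coordinate
`w = 1/z`. -/
def paramInfty : ℂ → RSphere := fun w => if w = 0 then OnePoint.infty else ((w⁻¹ : ℂ) : OnePoint ℂ)

/-- `σ` is one of the two standard holomorphic parametrizations; together they form a holomorphic
atlas of the Riemann sphere. -/
def IsParam (σ : ℂ → RSphere) : Prop := σ = paramZero ∨ σ = paramInfty

/-- The map `f`, restricted to the open subset `M` of the Riemann sphere, is a conformal minimal
immersion: it is one in each of the two coordinates. Only the values of `f` on `M` matter. -/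
def IsConformalMinimalImmersion {n : ℕ} (f : RSphere → EuclideanSpace ℝ (Fin n))
    (M : Set RSphere) : Prop :=
  ∀ σ, IsParam σ → IsConformalMinimalOn (f ∘ σ) (σ ⁻¹' M)

/-- `γ : [0,1] → M` is a curve of class `C¹` in the Riemann sphere with values in `M`: near each
time it is a `C¹` curve in one of the two coordinates. -/
def IsC1CurveIn (M : Set RSphere) (γ : ℝ → RSphere) : Prop :=
  ∀ t ∈ Set.Icc (0 : ℝ) 1, γ t ∈ M ∧
    ∃ (σ : ℂ → RSphere) (η : ℝ → ℂ), IsParam σ ∧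
      ContDiffWithinAt ℝ 1 η (Set.Icc 0 1) t ∧
      γ =ᶠ[nhdsWithin t (Set.Icc 0 1)] σ ∘ η

/-- The length of the curve `γ : [0,1] → M` for the Riemannian metric induced by `f`. The norm of
`γ'(t)` in this metric is the Euclidean norm of `df(γ'(t)) = (f ∘ γ)'(t)`. -/
def inducedLength {n : ℕ} (f : RSphere → EuclideanSpace ℝ (Fin n)) (γ : ℝ → RSphere) : ENNReal :=
  ∫⁻ t in Set.Icc (0 : ℝ) 1, ‖deriv (f ∘ γ) t‖ₑ

/-- The Riemannian distance on `M` for the metric induced by `f`: the infimum of the lengths of the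
`C¹` curves in `M` that join the two points. -/
def inducedEDist {n : ℕ} (f : RSphere → EuclideanSpace ℝ (Fin n)) (M : Set RSphere)
    (p q : RSphere) : ENNReal :=
  ⨅ (γ : ℝ → RSphere) (_ : IsC1CurveIn M γ ∧ γ 0 = p ∧ γ 1 = q), inducedLength f γ

/-- The metric induced by `f` on `M` is complete: every Cauchy sequence of `M` for the Riemannian
distance converges in `M`. -/
def IsCompleteImmersion {n : ℕ} (f : RSphere → EuclideanSpace ℝ (Fin n)) (M : Set RSphere) : Prop :=
  ∀ x : ℕ → RSphere, (∀ i, x i ∈ M) →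
    (∀ ε : ENNReal, 0 < ε → ∃ N, ∀ i j, N ≤ i → N ≤ j → inducedEDist f M (x i) (x j) < ε) →
    ∃ p ∈ M, Filter.Tendsto (fun i => inducedEDist f M (x i) p) Filter.atTop (nhds 0)

/-- `f` is full on `M`: the image `f(M)` is not contained in any (affine) hyperplane. -/
def IsFull {n : ℕ} (f : RSphere → EuclideanSpace ℝ (Fin n)) (M : Set RSphere) : Prop :=
  ∀ (a : EuclideanSpace ℝ (Fin n)) (c : ℝ), a ≠ 0 → ¬ ∀ p ∈ M, inner ℝ a (f p) = c

/-- The curvature form `K dA` in the coordinate `z`, as a density with respect to `du dv`. -/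
def curvatureDensity {n : ℕ} (f : RSphere → EuclideanSpace ℝ (Fin n)) (z : ℂ) : ℝ :=
  gaussCurvature (f ∘ paramZero) z * areaDensity (f ∘ paramZero) z

/-- The total curvature of `f` on `M` is finite: `K dA` is integrable on `M`. The coordinate `z`
misses at most the single point `∞` of `M`, which has area zero. -/
def HasFiniteTotalCurvature {n : ℕ} (f : RSphere → EuclideanSpace ℝ (Fin n))
    (M : Set RSphere) : Prop :=
  MeasureTheory.IntegrableOn (curvatureDensity f) (paramZero ⁻¹' M)

/-- The total curvature `∫_M K dA`. -/
def totalCurvature {n : ℕ} (f : RSphere → EuclideanSpace ℝ (Fin n)) (M : Set RSphere) : ℝ :=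
  ∫ z in paramZero ⁻¹' M, curvatureDensity f z

/-- The image `ν(M)` in complex projective space `ℂP^(n-1)` of the Gauss map `ν = [∂f/∂z]`. -/
def gaussImage {n : ℕ} (f : RSphere → EuclideanSpace ℝ (Fin n)) (M : Set RSphere) :
    Set (Projectivization ℂ (Fin n → ℂ)) :=
  {P | ∃ (σ : ℂ → RSphere) (z : ℂ), IsParam σ ∧ σ z ∈ M ∧
    ∃ h : complexPartial (f ∘ σ) z ≠ 0, P = Projectivization.mk ℂ (complexPartial (f ∘ σ) z) h}

/-- The Gauss image is contained in the projective subspace of lines of `W`. -/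
def GaussImageIn {n : ℕ} (f : RSphere → EuclideanSpace ℝ (Fin n)) (M : Set RSphere)
    (W : Submodule ℂ (Fin n → ℂ)) : Prop :=
  ∀ P ∈ gaussImage f M, P.submodule ≤ W

/-- The Gauss map is non-degenerate: its image lies in no proper projective subspace. -/
def HasNondegenerateGaussMap {n : ℕ} (f : RSphere → EuclideanSpace ℝ (Fin n))
    (M : Set RSphere) : Prop :=
  ∀ W : Submodule ℂ (Fin n → ℂ), GaussImageIn f M W → W = ⊤

/-- The number of ends of the sphere punctured at the points outside `M`. -/
def numEnds (M : Set RSphere) : ℕ := Mᶜ.ncard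

/-- `χ` is the Euler number of the compact space `X`: the alternating sum of the numbers of cells
of a finite CW decomposition of `X`. -/
def HasCellularEulerNumber (X : Type) [TopologicalSpace X] (χ : ℤ) : Prop :=
  ∃ c : Topology.CWComplex (Set.univ : Set X),
    Finite (Σ n, c.cell n) ∧ χ = ∑ᶠ n : ℕ, (-1) ^ n * (Nat.card (c.cell n) : ℤ)

/-- `χ` is the Euler number of `M`, the Riemann sphere punctured at finitely many points; each
puncture lowers the Euler number of the compact surface by one. -/
def HasEulerNumber (M : Set RSphere) (χ : ℤ) : Prop :=
  Mᶜ.Finite ∧ ∃ χ₀ : ℤ, HasCellularEulerNumber RSphere χ₀ ∧ χ = χ₀ - numEnds M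

/-- Equality in the Chern–Osserman inequality `TC ≤ 2π(χ - k)`, where `k` is the number of ends and
`χ` is the Euler number of `M`. -/
def AttainsChernOsserman {n : ℕ} (f : RSphere → EuclideanSpace ℝ (Fin n)) (M : Set RSphere)
    (χ : ℤ) : Prop :=
  totalCurvature f M = 2 * Real.pi * ((χ : ℝ) - numEnds M)

/-- Equality in Ejiri's inequality `TC ≤ (χ + k - 2n + 2l)π`, which is attached to a Gauss image
contained in an `(n-1-l)`-dimensional projective subspace of `ℂP^(n-1)`. -/
def AttainsEjiri {n : ℕ} (f : RSphere → EuclideanSpace ℝ (Fin n)) (M : Set RSphere)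
    (χ : ℤ) (l : ℕ) : Prop :=
  (∃ W : Submodule ℂ (Fin n → ℂ), Module.finrank ℂ W + l = n ∧ GaussImageIn f M W) ∧
    totalCurvature f M = ((χ : ℝ) + numEnds M - 2 * n + 2 * l) * Real.pi

/-! ### The Weierstrass data -/

/-- `g_j(z) = z^j (1 - z^(2m-2j)) / (z^(m+1) - 1)²`. -/
def jmG (m j : ℕ) (z : ℂ) : ℂ := z ^ j * (1 - z ^ (2 * m - 2 * j)) / (z ^ (m + 1) - 1) ^ 2

/-- `h_j(z) = i z^j (1 + z^(2m-2j)) / (z^(m+1) - 1)²`. -/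
def jmH (m j : ℕ) (z : ℂ) : ℂ :=
  Complex.I * z ^ j * (1 + z ^ (2 * m - 2 * j)) / (z ^ (m + 1) - 1) ^ 2

/-- The coefficient with respect to `dz` of the integrand
`(g_0, h_0, g_1, h_1, …, g_{m-1}, h_{m-1}, 2√m z^m / (z^(m+1) - 1)²)`. -/
def jmData (m : ℕ) (z : ℂ) (k : Fin (2 * m + 1)) : ℂ :=
  if (k : ℕ) = 2 * m then 2 * (Real.sqrt m : ℂ) * z ^ m / (z ^ (m + 1) - 1) ^ 2
  else if (k : ℕ) % 2 = 0 then jmG m ((k : ℕ) / 2) z else jmH m ((k : ℕ) / 2) z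

/-- The Riemann sphere minus the `(m+1)`-th roots of unity. -/
def jmDomain (m : ℕ) : Set RSphere := (paramZero '' {z : ℂ | z ^ (m + 1) = 1})ᶜ

/-- `f = Re ∫_{z₀}^z (data) dz` on the finite points of the domain, along every `C¹` path from `z₀`
to `z` that avoids the `(m+1)`-th roots of unity; in particular the integral does not depend on the
path. -/
def IsJorgeMeeksIntegral (m : ℕ) (z₀ : ℂ) (f : RSphere → EuclideanSpace ℝ (Fin (2 * m + 1))) :
    Prop :=
  ∀ (z : ℂ) (γ : Path z₀ z), ContDiffOn ℝ 1 γ.extend (Set.Icc 0 1) →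
    (∀ t, paramZero (γ t) ∈ jmDomain m) →
    ∀ k, f (paramZero z) k =
      (curveIntegral (fun w => ContinuousLinearMap.toSpanSingleton ℂ (jmData m w k)) γ).re

end

/-! The integrand φ is isotropic: with P = z^(m+1) - 1, each pair satisfies g_j² + h_j² = -4
z^(2m)/P⁴, and the last entry, whose square is 4m z^(2m)/P⁴, cancels the m pairs. Hence Re ∫ φ dz is
conformal and harmonic, so minimal, with conformal factor λ = Q(|z|²)/|P|⁴, where Q(r) = 1 + r + ⋯ +
r^(2m) + (2m-1) r^m (`sum_jmData_sq`, `sum_norm_jmData_sq`, `IsWeierstrassOn`).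

Path independence comes from an explicit primitive. Partial fractions at the roots of unity ζ show
that the residues of φ are real, so the primitive is a real combination of log|z - ζ| plus the real
part of a rational function (`pow_div_eq_sum`, `hasFDerivAt_jmPrim`). With suitable constants the
inversion z ↦ 1/z only changes signs of its coordinates (`jmPrim_inv`). This defines the extension
over ∞ and makes the two charts of the sphere look alike, so each local computation is done once.

Curvature: log|P| is harmonic, so K dA = -½ Δ log Q(|z|²) du dv. The Laplacian is radial, and polar
coordinates give ∫ Δ log Q(|z|²) = 4π deg Q = 8πm. Cauchy–Schwarz on the coefficients of Q makes the
integrand nonnegative, hence integrable (`integral_laplacian_log_eval`).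

Completeness: the functions u_q = z^q/P for q = 0, 1 are Lipschitz for the induced distance
(`norm_fderiv_jmQuot_le`), so they converge along a Cauchy sequence. Their limits determine the
limit point, as z = u_1/u_0 or z = ∞, and boundedness of u_0 keeps it away from the punctures.

Fullness and non-degeneracy both say that the entries of φ are linearly independent over ℂ, which is
seen on the coefficients of their numerators (`eq_zero_of_sum_mul_jmData`). The sphere has Euler
number 2 by a decomposition into one vertex and one face, so χ = 2 - (m+1), and both equalities
reduce to arithmetic. -/

noncomputable section

/-! ### The Weierstrass representation -/

/-- The real part of a vector of `ℂⁿ`. -/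
def reVec (n : ℕ) : (Fin n → ℂ) →L[ℝ] EuclideanSpace ℝ (Fin n) :=
  (EuclideanSpace.equiv (Fin n) ℝ).symm.toContinuousLinearMap ∘L
    ContinuousLinearMap.pi fun k => Complex.reCLM ∘L ContinuousLinearMap.proj k

/-- The real linear map `v ↦ Re (v c)`, which is the differential of `Re ∫ φ dz` where `φ = c`. -/
def weierstrassDeriv {n : ℕ} (c : Fin n → ℂ) : ℂ →L[ℝ] EuclideanSpace ℝ (Fin n) :=
  reVec n ∘L (ContinuousLinearMap.toSpanSingleton ℂ c).restrictScalars ℝ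

lemma weierstrassDeriv_eq {n : ℕ} (c : Fin n → ℂ) (v : ℂ) :
    weierstrassDeriv c v = reVec n (v • c) := rfl

@[simp] lemma weierstrassDeriv_apply {n : ℕ} (c : Fin n → ℂ) (v : ℂ) (k : Fin n) :
    weierstrassDeriv c v k = (v * c k).re := rfl

/-- Each product Re(ac) Re(bc) splits into ½ Re(ab c²) and ½ Re(a b̄) |c|². Isotropy removes the sum
of the first parts, and what remains is a multiple of the Euclidean inner product of ℂ: this is
conformality. -/
lemma inner_weierstrassDeriv {n : ℕ} {c : Fin n → ℂ} (hc : ∑ k, c k ^ 2 = 0) (a b : ℂ) :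
    inner ℝ (weierstrassDeriv c a) (weierstrassDeriv c b)
      = (a.re * b.re + a.im * b.im) * ((∑ k, ‖c k‖ ^ 2) / 2) := by
  have key : ∀ k, (a * c k).re * (b * c k).re
      = (a * b * c k ^ 2).re / 2 + (a.re * b.re + a.im * b.im) * (‖c k‖ ^ 2 / 2) := by
    intro k
    rw [← Complex.normSq_eq_norm_sq, Complex.normSq_apply]
    simp only [pow_two, Complex.mul_re, Complex.mul_im]
    ring
  have h2 : ∑ k, (a * b * c k ^ 2).re / 2 = 0 := by
    rw [← Finset.sum_div, ← Complex.re_sum, ← Finset.mul_sum, hc]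
    simp
  rw [PiLp.inner_apply]
  simp only [weierstrassDeriv_apply, RCLike.inner_apply, conj_trivial]
  rw [Finset.sum_congr rfl fun k _ => (mul_comm _ _).trans (key k), Finset.sum_add_distrib, h2,
    zero_add, Finset.sum_div, Finset.mul_sum]

lemma norm_weierstrassDeriv {n : ℕ} {c : Fin n → ℂ} (hc : ∑ k, c k ^ 2 = 0) (a : ℂ) :
    ‖weierstrassDeriv c a‖ = ‖a‖ * Real.sqrt ((∑ k, ‖c k‖ ^ 2) / 2) := by
  rw [norm_eq_sqrt_real_inner, inner_weierstrassDeriv hc,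
    Real.sqrt_mul (add_nonneg (mul_self_nonneg _) (mul_self_nonneg _)), Complex.norm_def,
    Complex.normSq_apply]

/-- `F` is locally the real part of the integral of the holomorphic vector `φ` on `U`. -/
structure IsWeierstrassOn {n : ℕ} (F : ℂ → EuclideanSpace ℝ (Fin n)) (φ : ℂ → Fin n → ℂ)
    (U : Set ℂ) : Prop where
  isOpen : IsOpen U
  hasFDerivAt : ∀ z ∈ U, HasFDerivAt F (weierstrassDeriv (φ z)) z
  holomorphic : DifferentiableOn ℂ φ U
  isotropic : ∀ z ∈ U, ∑ k, φ z k ^ 2 = 0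
  ne_zero : ∀ z ∈ U, φ z ≠ 0

namespace IsWeierstrassOn

variable {n : ℕ} {F : ℂ → EuclideanSpace ℝ (Fin n)} {φ : ℂ → Fin n → ℂ} {U : Set ℂ}

lemma partialD_eq (h : IsWeierstrassOn F φ U) (e : ℂ) {z : ℂ} (hz : z ∈ U) :
    partialD F e z = weierstrassDeriv (φ z) e := by
  rw [partialD, (h.hasFDerivAt z hz).fderiv]

lemma partialD_partialD_eq (h : IsWeierstrassOn F φ U) (e e' : ℂ) {z : ℂ} (hz : z ∈ U) :
    partialD (partialD F e) e' z = reVec n ((e * e') • deriv φ z) := by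
  have hev : partialD F e =ᶠ[nhds z] fun w => reVec n (e • φ w) := by
    filter_upwards [h.isOpen.mem_nhds hz] with w hw
    rw [h.partialD_eq e hw, weierstrassDeriv_eq]
  have hφ : HasFDerivAt φ _ z := ((h.holomorphic.differentiableAt
    (h.isOpen.mem_nhds hz)).hasDerivAt.hasFDerivAt.restrictScalars ℝ)
  have h2 : HasFDerivAt (fun w => reVec n (e • φ w)) _ z :=
    (reVec n).hasFDerivAt.comp z (hφ.const_smul e)
  rw [partialD, hev.fderiv_eq, h2.fderiv]
  simp [mul_smul]

lemma coeffE_eq (h : IsWeierstrassOn F φ U) {z : ℂ} (hz : z ∈ U) :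
    coeffE F z = (∑ k, ‖φ z k‖ ^ 2) / 2 := by
  rw [coeffE, h.partialD_eq 1 hz, inner_weierstrassDeriv (h.isotropic z hz)]
  simp

lemma coeffG_eq (h : IsWeierstrassOn F φ U) {z : ℂ} (hz : z ∈ U) :
    coeffG F z = (∑ k, ‖φ z k‖ ^ 2) / 2 := by
  rw [coeffG, h.partialD_eq _ hz, inner_weierstrassDeriv (h.isotropic z hz)]
  simp

lemma coeffF_eq (h : IsWeierstrassOn F φ U) {z : ℂ} (hz : z ∈ U) : coeffF F z = 0 := by
  rw [coeffF, h.partialD_eq _ hz, h.partialD_eq _ hz, inner_weierstrassDeriv (h.isotropic z hz)]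
  simp

lemma sum_pos (h : IsWeierstrassOn F φ U) {z : ℂ} (hz : z ∈ U) :
    0 < (∑ k, ‖φ z k‖ ^ 2) / 2 := by
  obtain ⟨k, hk⟩ := Function.ne_iff.mp (h.ne_zero z hz)
  have : 0 < ∑ k, ‖φ z k‖ ^ 2 :=
    Finset.sum_pos' (fun _ _ => by positivity) ⟨k, Finset.mem_univ _, by
      have := norm_pos_iff.mpr hk
      positivity⟩
  positivity

lemma areaDensity_eq (h : IsWeierstrassOn F φ U) {z : ℂ} (hz : z ∈ U) :
    areaDensity F z = coeffE F z := by
  have := h.sum_pos hz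
  rw [areaDensity, h.coeffE_eq hz, h.coeffF_eq hz, h.coeffG_eq hz, pow_two, mul_zero, sub_zero,
    Real.sqrt_mul_self this.le]

lemma complexPartial_eq (h : IsWeierstrassOn F φ U) {z : ℂ} (hz : z ∈ U) :
    complexPartial F z = (2⁻¹ : ℂ) • φ z := by
  funext k
  rw [complexPartial, h.partialD_eq _ hz, h.partialD_eq _ hz]
  simp only [weierstrassDeriv_apply, one_mul, Complex.I_mul_re, Complex.ofReal_neg, mul_neg,
    sub_neg_eq_add, Pi.smul_apply, smul_eq_mul]
  rw [mul_comm Complex.I, Complex.re_add_im]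
  ring

lemma contDiffOn (h : IsWeierstrassOn F φ U) : ContDiffOn ℝ (⊤ : ℕ∞) F U := by
  -- The differential is a continuous linear function of the holomorphic, hence smooth, vector φ.
  rw [contDiffOn_infty_iff_fderiv_of_isOpen h.isOpen]
  refine ⟨fun z hz => (h.hasFDerivAt z hz).differentiableAt.differentiableWithinAt, ?_⟩
  have h1 : ContDiffOn ℝ (⊤ : ℕ∞) φ U := (h.holomorphic.contDiffOn h.isOpen).restrict_scalars ℝ
  have h2 : ContDiffOn ℝ (⊤ : ℕ∞) (fun z => (ContinuousLinearMap.compL ℝ ℂ (Fin n → ℂ) _ (reVec n))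
      ((ContinuousLinearMap.restrictScalarsL ℂ ℂ (Fin n → ℂ) ℝ ℝ)
        (ContinuousLinearMap.toSpanSingletonCLE (𝕜 := ℂ) (φ z)))) U := by
    refine (ContinuousLinearMap.contDiff _).comp_contDiffOn
      ((ContinuousLinearMap.contDiff _).comp_contDiffOn ?_)
    exact ((ContinuousLinearEquiv.contDiff _).restrict_scalars ℝ).comp_contDiffOn h1
  refine h2.congr fun z hz => ?_
  rw [(h.hasFDerivAt z hz).fderiv]
  rfl

lemma isConformalMinimalOn (h : IsWeierstrassOn F φ U) : IsConformalMinimalOn F U where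
  isOpen := h.isOpen
  smooth := h.contDiffOn
  immersion z hz := by
    rw [(h.hasFDerivAt z hz).fderiv]
    refine (injective_iff_map_eq_zero _).mpr fun a ha => ?_
    have h1 := norm_weierstrassDeriv (h.isotropic z hz) a
    rw [ha, norm_zero, eq_comm, mul_eq_zero] at h1
    exact norm_eq_zero.mp (h1.resolve_right (Real.sqrt_pos.mpr (h.sum_pos hz)).ne')
  conformal z hz := ⟨by rw [h.coeffE_eq hz, h.coeffG_eq hz], h.coeffF_eq hz⟩
  minimal z hz := by
    -- Since E = G and F = 0, the vector to be projected is E (F_uu + F_vv) = E · Re((1 + i²) φ'),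
    -- which is zero before the projection.
    rw [meanCurvatureVector, h.coeffE_eq hz, h.coeffG_eq hz, h.coeffF_eq hz,
      h.partialD_partialD_eq _ _ hz, h.partialD_partialD_eq _ _ hz, h.partialD_partialD_eq _ _ hz]
    simp [normalPart]

end IsWeierstrassOn

/-! ### A cell decomposition of the Riemann sphere -/

namespace SphereCW

open Metric Set Topology

/-- The coordinates of the plane `ℂ`. -/
def planeHomeo : (Fin 2 → ℝ) ≃ₜ ℂ :=
  Homeomorph.finTwoArrow.trans Complex.equivRealProdCLM.toHomeomorph.symm

/-- The open unit square, mapped onto the plane. -/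
def squareHomeo : OpenPartialHomeomorph (Fin 2 → ℝ) ℂ :=
  OpenPartialHomeomorph.univUnitBall.symm.trans planeHomeo.toOpenPartialHomeomorph

lemma squareHomeo_source : squareHomeo.source = ball 0 1 := by
  simp [squareHomeo, OpenPartialHomeomorph.univUnitBall]

lemma squareHomeo_target : squareHomeo.target = univ := by
  simp [squareHomeo, OpenPartialHomeomorph.univUnitBall]

open Classical in
/-- The closed unit square, mapped onto the sphere by collapsing the boundary to `∞`. -/
def faceMap (x : Fin 2 → ℝ) : RSphere :=
  if x ∈ ball (0 : Fin 2 → ℝ) 1 then ((squareHomeo x : ℂ) : OnePoint ℂ) else OnePoint.infty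

lemma faceMap_of_mem {x : Fin 2 → ℝ} (hx : x ∈ ball (0 : Fin 2 → ℝ) 1) :
    faceMap x = ((squareHomeo x : ℂ) : OnePoint ℂ) := if_pos hx

lemma faceMap_of_notMem {x : Fin 2 → ℝ} (hx : x ∉ ball (0 : Fin 2 → ℝ) 1) :
    faceMap x = OnePoint.infty := if_neg hx

lemma continuous_faceMap : Continuous faceMap := by
  rw [continuous_iff_continuousAt]
  intro x
  by_cases hx : x ∈ ball (0 : Fin 2 → ℝ) 1
  · have h1 : ContinuousAt (fun y => ((squareHomeo y : ℂ) : OnePoint ℂ)) x :=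
      OnePoint.continuous_coe.continuousAt.comp
        (squareHomeo.continuousAt (squareHomeo_source ▸ hx))
    refine h1.congr ?_
    filter_upwards [isOpen_ball.mem_nhds hx] with y hy using (faceMap_of_mem hy).symm
  -- A neighbourhood of ∞ omits a compact K ⊆ ℂ. Its preimage in the open square is compact, so the
  -- complement of that preimage is a neighbourhood of the boundary point x.
  · rw [ContinuousAt, faceMap_of_notMem hx, OnePoint.hasBasis_nhds_infty.tendsto_right_iff]
    rintro K ⟨-, hK⟩
    have hc : IsCompact (squareHomeo.symm '' K) :=
      hK.image_of_continuousOn (squareHomeo.continuousOn_symm.mono (by simp [squareHomeo_target]))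
    have hxK : x ∉ squareHomeo.symm '' K := by
      rintro ⟨k, -, rfl⟩
      exact hx (squareHomeo_source ▸ squareHomeo.map_target (by simp [squareHomeo_target]))
    filter_upwards [hc.isClosed.isOpen_compl.mem_nhds hxK] with y hy
    by_cases hyb : y ∈ ball (0 : Fin 2 → ℝ) 1
    · rw [faceMap_of_mem hyb]
      exact Or.inl ⟨_, fun hk => hy ⟨_, hk, squareHomeo.left_inv (squareHomeo_source ▸ hyb)⟩, rfl⟩
    · rw [faceMap_of_notMem hyb]
      exact Or.inr rfl

/-- The characteristic map of the two-dimensional cell. -/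
def face : PartialEquiv (Fin 2 → ℝ) RSphere where
  toFun := faceMap
  invFun p := OnePoint.elim p 0 squareHomeo.symm
  source := ball 0 1
  target := range ((↑) : ℂ → OnePoint ℂ)
  map_source' x hx := ⟨_, (faceMap_of_mem hx).symm⟩
  map_target' := by
    rintro _ ⟨z, rfl⟩
    change squareHomeo.symm z ∈ ball 0 1
    rw [← squareHomeo_source]
    exact squareHomeo.map_target (by simp [squareHomeo_target])
  left_inv' x hx := by
    rw [faceMap_of_mem hx]
    exact squareHomeo.left_inv (squareHomeo_source ▸ hx)
  right_inv' := by
    rintro _ ⟨z, rfl⟩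
    have hz : z ∈ squareHomeo.target := by simp [squareHomeo_target]
    change faceMap (squareHomeo.symm z) = _
    rw [faceMap_of_mem (squareHomeo_source ▸ squareHomeo.map_target hz), squareHomeo.right_inv hz]

/-- The cells: a vertex and a face. -/
def cells : ℕ → Type
  | 0 => Unit
  | 2 => Unit
  | _ => Empty

/-- The characteristic maps of the cells. -/
def cellMap : (n : ℕ) → cells n → PartialEquiv (Fin n → ℝ) RSphere
  | 0, _ => PartialEquiv.single ![] OnePoint.infty
  | 1, i => i.elim
  | 2, _ => face
  | _ + 3, i => i.elim

lemma image_face_ball : face '' ball 0 1 = range ((↑) : ℂ → OnePoint ℂ) :=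
  face.image_source_eq_target

lemma image_face_closedBall : face '' closedBall 0 1 = univ := by
  refine eq_univ_of_forall fun (p : OnePoint ℂ) => ?_
  induction p using OnePoint.rec with
  | infty =>
    -- The constant function 1 is a corner of the square, of sup norm 1, so it is collapsed to ∞.
    refine ⟨1, by simp, faceMap_of_notMem (by simp)⟩
  | coe z =>
    obtain ⟨x, hx, h⟩ := image_face_ball.ge (mem_range_self z)
    exact ⟨x, ball_subset_closedBall hx, h⟩

/-- The cell decomposition of the sphere with one vertex and one face. -/
@[reducible] def cwComplex : CWComplex (univ : Set RSphere) :=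
  CWComplex.mkFinite univ cells cellMap
    (by
      filter_upwards [Filter.eventually_ge_atTop 3] with n hn
      obtain ⟨k, rfl⟩ := Nat.exists_eq_add_of_le' hn
      exact inferInstanceAs (IsEmpty Empty))
    (fun n => match n with
      | 0 => inferInstanceAs (Finite Unit)
      | 1 => inferInstanceAs (Finite Empty)
      | 2 => inferInstanceAs (Finite Unit)
      | _ + 3 => inferInstanceAs (Finite Empty))
    (fun n i => match n, i with
      | 0, _ => Subset.antisymm (fun x _ => by simp [Subsingleton.elim x 0])
          (fun x _ => Subsingleton.elim _ _)
      | 2, _ => rfl)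
    (fun n i => match n, i with
      | 0, _ => (continuous_of_discreteTopology).continuousOn
      | 2, _ => show ContinuousOn faceMap _ from continuous_faceMap.continuousOn)
    (fun n i => match n, i with
      | 0, _ => by
        simp only [cellMap, PartialEquiv.single]
        exact continuousOn_const
      | 2, _ => by
        change ContinuousOn face.symm (range ((↑) : ℂ → OnePoint ℂ))
        rintro _ ⟨z, rfl⟩
        refine ContinuousAt.continuousWithinAt ?_
        rw [OnePoint.continuousAt_coe]
        exact squareHomeo.symm.continuousAt (by simp [squareHomeo_target]))
    (by
      have key : ∀ i j, Disjoint (cellMap 0 i '' ball 0 1) (cellMap 2 j '' ball 0 1) := by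
        intro i j
        rw [disjoint_left]
        rintro _ ⟨x, -, rfl⟩ h
        have : face '' ball 0 1 = range ((↑) : ℂ → OnePoint ℂ) := image_face_ball
        obtain ⟨z, hz⟩ := this.le h
        exact OnePoint.coe_ne_infty z hz
      rintro ⟨n, i⟩ - ⟨n', j⟩ - hij
      match n, i, n', j with
      | 0, (), 0, () => exact (hij rfl).elim
      | 0, i, 2, j => exact key i j
      | 2, i, 0, j => exact (key j i).symm
      | 2, (), 2, () => exact (hij rfl).elim)
    (fun n i => match n, i with
      | 0, _ => by simp [sphere_eq_empty_of_subsingleton]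
      | 2, _ => by
        intro x hx
        refine mem_iUnion₂.mpr ⟨0, by norm_num, mem_iUnion.mpr ⟨(), ![], by simp, ?_⟩⟩
        change OnePoint.infty = faceMap x
        rw [faceMap_of_notMem]
        rw [mem_ball_zero_iff, mem_sphere_zero_iff_norm.mp hx]
        exact lt_irrefl _)
    (eq_univ_of_univ_subset ((image_face_closedBall).ge.trans
      (subset_iUnion₂ (s := fun n i => cellMap n i '' closedBall 0 1) 2 ())))

end SphereCW

lemma hasCellularEulerNumber_sphere : HasCellularEulerNumber RSphere 2 := by
  refine ⟨SphereCW.cwComplex, ?_, ?_⟩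
  · change Finite (Σ n, SphereCW.cells n)
    refine Finite.of_surjective
      (fun b : Bool => (bif b then ⟨0, ()⟩ else ⟨2, ()⟩ : Σ n, SphereCW.cells n)) ?_
    rintro ⟨n, i⟩
    match n, i with
    | 0, () => exact ⟨true, rfl⟩
    | 2, () => exact ⟨false, rfl⟩
  · have h2 : (Function.support fun n : ℕ => (-1) ^ n * (Nat.card (SphereCW.cells n) : ℤ))
        ⊆ ({0, 2} : Finset ℕ) := by
      intro n hn
      match n with
      | 0 => simp
      | 1 => exact (hn (by simp [SphereCW.cells])).elim
      | 2 => simp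
      | k + 3 => exact (hn (by simp [SphereCW.cells])).elim
    change (2 : ℤ) = ∑ᶠ n : ℕ, (-1) ^ n * (Nat.card (SphereCW.cells n) : ℤ)
    rw [finsum_eq_sum_of_support_subset _ h2]
    simp [SphereCW.cells]

/-! ### Primitives of the Weierstrass data -/

/-- The real linear map `v ↦ Re (v c)`. -/
def reDeriv (c : ℂ) : ℂ →L[ℝ] ℝ :=
  Complex.reCLM ∘L (ContinuousLinearMap.toSpanSingleton ℂ c).restrictScalars ℝ

@[simp] lemma reDeriv_apply (c v : ℂ) : reDeriv c v = (v * c).re := rfl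

lemma HasDerivAt.hasFDerivAt_re {g : ℂ → ℂ} {c z : ℂ} (h : HasDerivAt g c z) :
    HasFDerivAt (fun w => (g w).re) (reDeriv c) z :=
  Complex.reCLM.hasFDerivAt.comp z (h.hasFDerivAt.restrictScalars ℝ)

/-- Both log(w - a) and log(-(w - a)) have real part log|w - a| and derivative 1/(w - a), and at any
point z ≠ a at least one of them is off the branch cut. -/
lemma hasFDerivAt_log_norm_sub {z a : ℂ} (h : z ≠ a) :
    HasFDerivAt (fun w => Real.log ‖w - a‖) (reDeriv (z - a)⁻¹) z := by
  rcases Complex.mem_slitPlane_or_neg_mem_slitPlane (sub_ne_zero.mpr h) with hs | hs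
  · have h1 : HasDerivAt (fun w => Complex.log (w - a)) (1 / (z - a)) z :=
      ((hasDerivAt_id z).sub_const a).clog hs
    rw [one_div] at h1
    simpa only [Complex.log_re] using h1.hasFDerivAt_re
  · have h1 : HasDerivAt (fun w => Complex.log (-(w - a))) (-1 / (-(z - a))) z :=
      ((hasDerivAt_id z).sub_const a).neg.clog hs
    rw [neg_div_neg_eq, one_div] at h1
    simpa only [Complex.log_re, norm_neg] using h1.hasFDerivAt_re

lemma hasFDerivAt_weierstrassDeriv {n : ℕ} {F : ℂ → EuclideanSpace ℝ (Fin n)} {c : Fin n → ℂ}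
    {z : ℂ} (h : ∀ k, HasFDerivAt (fun w => F w k) (reDeriv (c k)) z) :
    HasFDerivAt F (weierstrassDeriv c) z :=
  hasFDerivWithinAt_univ.mp (hasFDerivWithinAt_euclidean.mpr fun k => (h k).hasFDerivWithinAt)

/-- The `(m+1)`-th roots of unity. -/
def jmRoots (m : ℕ) : Finset ℂ := Polynomial.nthRootsFinset (m + 1) (1 : ℂ)

lemma mem_jmRoots {m : ℕ} {ζ : ℂ} : ζ ∈ jmRoots m ↔ ζ ^ (m + 1) = 1 :=
  Polynomial.mem_nthRootsFinset m.succ_pos 1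

lemma card_jmRoots (m : ℕ) : (jmRoots m).card = m + 1 :=
  (Complex.isPrimitiveRoot_exp (m + 1) m.succ_ne_zero).card_nthRootsFinset

lemma norm_of_mem_jmRoots {m : ℕ} {ζ : ℂ} (h : ζ ∈ jmRoots m) : ‖ζ‖ = 1 :=
  Complex.norm_eq_one_of_pow_eq_one (mem_jmRoots.mp h) m.succ_ne_zero

lemma conj_mem_jmRoots {m : ℕ} {ζ : ℂ} (h : ζ ∈ jmRoots m) : starRingEnd ℂ ζ ∈ jmRoots m := by
  rw [mem_jmRoots, ← map_pow, mem_jmRoots.mp h, map_one]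

lemma conj_pow_of_mem_jmRoots {m : ℕ} {ζ : ℂ} (h : ζ ∈ jmRoots m) {i j : ℕ} (hij : i + j = m + 1) :
    starRingEnd ℂ (ζ ^ i) = ζ ^ j := by
  have h1 : ζ ^ i * ζ ^ j = 1 := by rw [← pow_add, hij, mem_jmRoots.mp h]
  rw [← Complex.inv_eq_conj (by rw [norm_pow, norm_of_mem_jmRoots h, one_pow])]
  exact inv_eq_of_mul_eq_one_right h1

lemma sum_jmRoots_conj {m : ℕ} {E : Type*} [AddCommMonoid E] (F : ℂ → E) :
    ∑ ζ ∈ jmRoots m, F (starRingEnd ℂ ζ) = ∑ ζ ∈ jmRoots m, F ζ :=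
  Finset.sum_nbij' (starRingEnd ℂ) (starRingEnd ℂ) (fun _ => conj_mem_jmRoots)
    (fun _ => conj_mem_jmRoots) (fun _ _ => Complex.conj_conj _) (fun _ _ => Complex.conj_conj _)
    (fun _ _ => rfl)

lemma sub_ne_zero_of_mem_jmRoots {m : ℕ} {z ζ : ℂ} (hz : z ^ (m + 1) ≠ 1) (h : ζ ∈ jmRoots m) :
    z - ζ ≠ 0 := by
  rintro h0
  rw [sub_eq_zero] at h0
  exact hz (h0 ▸ mem_jmRoots.mp h)

/-- Lagrange interpolation at the m + 1 roots of unity reproduces z^j because j ≤ m. The nodal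
weight at ζ is the inverse of the derivative (m+1) ζ^m of the nodal polynomial, and 1/ζ^m = ζ. -/
lemma pow_div_eq_sum {m j : ℕ} (hj : j ≤ m) {z : ℂ} (hz : z ^ (m + 1) ≠ 1) :
    ∑ ζ ∈ jmRoots m, ζ ^ (j + 1) * (z - ζ)⁻¹ = (m + 1) * (z ^ j / (z ^ (m + 1) - 1)) := by
  have hnodal : Lagrange.nodal (jmRoots m) (id : ℂ → ℂ) = Polynomial.X ^ (m + 1) - 1 :=
    (Polynomial.X_pow_sub_one_eq_prod m.succ_pos
      (Complex.isPrimitiveRoot_exp (m + 1) m.succ_ne_zero)).symm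
  have hint : (Polynomial.X ^ j : Polynomial ℂ)
      = Lagrange.interpolate (jmRoots m) id fun ζ => ζ ^ j := by
    refine Lagrange.eq_interpolate_of_eval_eq _ (Set.injOn_id _) ?_ fun ζ _ => by simp
    rw [Polynomial.degree_X_pow, card_jmRoots]
    exact_mod_cast Nat.lt_succ_of_le hj
  have h := Lagrange.eval_interpolate_not_at_node (s := jmRoots m) (v := id) (x := z)
    (fun ζ => ζ ^ j) fun ζ hζ => sub_ne_zero.mp (sub_ne_zero_of_mem_jmRoots hz hζ)
  rw [← hint, hnodal] at h
  simp only [Polynomial.eval_pow, Polynomial.eval_X, Polynomial.eval_sub, Polynomial.eval_one] at h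
  rw [h, mul_div_cancel_left₀ _ (sub_ne_zero.mpr hz), Finset.mul_sum]
  refine Finset.sum_congr rfl fun ζ hζ => ?_
  have hm : (m + 1 : ℂ) ≠ 0 := by exact_mod_cast m.succ_ne_zero
  have h1 := mem_jmRoots.mp hζ
  have h0 : ζ ^ m ≠ 0 := by
    intro h0
    rw [pow_succ, h0, zero_mul] at h1
    exact zero_ne_one h1
  rw [Lagrange.nodalWeight_eq_eval_derivative_nodal hζ, hnodal]
  simp only [id, Polynomial.derivative_sub, Polynomial.derivative_X_pow, Polynomial.derivative_one,
    sub_zero, Polynomial.eval_mul, Polynomial.eval_C, Polynomial.eval_pow, Polynomial.eval_X,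
    Nat.add_sub_cancel]
  push_cast
  rw [pow_succ] at h1 ⊢
  field_simp
  rw [mul_assoc, mul_comm ζ, h1, mul_one]

lemma sum_pow_jmRoots {m j : ℕ} (hj : 1 ≤ j) (hjm : j ≤ m) : ∑ ζ ∈ jmRoots m, ζ ^ j = 0 := by
  -- The partial fraction expansion at z = 0 is -Σ ζ^j on one side and 0 on the other, as j ≥ 1.
  have h := pow_div_eq_sum (m := m) hjm (z := 0) (by simp)
  rw [zero_pow (by omega), zero_div, mul_zero] at h
  rw [← neg_eq_zero, ← h, ← Finset.sum_neg_distrib]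
  refine Finset.sum_congr rfl fun ζ hζ => ?_
  have h0 := sub_ne_zero_of_mem_jmRoots (z := 0) (m := m) (by simp) hζ
  rw [zero_sub] at h0 ⊢
  rw [pow_succ, mul_assoc, ← neg_neg (ζ * _), ← neg_mul, mul_inv_cancel₀ h0, mul_neg, mul_one]

/-- The sum of the logarithmic potentials at the `(m+1)`-th roots of unity with weights `a`. -/
def logSum (m : ℕ) (a : ℂ → ℝ) (z : ℂ) : ℝ := ∑ ζ ∈ jmRoots m, a ζ * Real.log ‖z - ζ‖

lemma hasFDerivAt_logSum {m : ℕ} (a : ℂ → ℝ) {z : ℂ} (hz : z ^ (m + 1) ≠ 1) :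
    HasFDerivAt (logSum m a) (reDeriv (∑ ζ ∈ jmRoots m, a ζ * (z - ζ)⁻¹)) z := by
  have h := HasFDerivAt.fun_sum fun ζ (hζ : ζ ∈ jmRoots m) => (hasFDerivAt_log_norm_sub
    (sub_ne_zero.mp (sub_ne_zero_of_mem_jmRoots hz hζ))).const_mul (a ζ)
  refine h.congr_fderiv ?_
  ext v
  simp only [sum_apply, smul_apply, reDeriv_apply,
    smul_eq_mul, Finset.mul_sum, Complex.re_sum]
  refine Finset.sum_congr rfl fun ζ _ => ?_
  rw [mul_left_comm, Complex.re_ofReal_mul]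

/-- Since |ζ| = 1, one has |1/w - ζ| = |w - ζ̄|/|w|. The terms log|w| disappear because the weights
sum to zero. -/
lemma logSum_inv {m : ℕ} (a : ℂ → ℝ) {w : ℂ} (h0 : w ≠ 0) (hw : w ^ (m + 1) ≠ 1)
    (ha : ∑ ζ ∈ jmRoots m, a ζ = 0) :
    logSum m a w⁻¹ = logSum m (fun ζ => a (starRingEnd ℂ ζ)) w := by
  have key : ∀ ζ ∈ jmRoots m, a ζ * Real.log ‖w⁻¹ - ζ‖
      = a ζ * Real.log ‖w - starRingEnd ℂ ζ‖ - a ζ * Real.log ‖w‖ := by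
    intro ζ hζ
    have h1 : w⁻¹ - ζ = -ζ * (w - starRingEnd ℂ ζ) / w := by
      have h2 : ζ * starRingEnd ℂ ζ = 1 := by
        rw [Complex.mul_conj, Complex.normSq_eq_norm_sq, norm_of_mem_jmRoots hζ]
        simp
      rw [mul_sub, neg_mul, neg_mul, h2]
      field_simp
      ring
    have h2 := sub_ne_zero_of_mem_jmRoots hw (conj_mem_jmRoots hζ)
    rw [h1, norm_div, norm_mul, norm_neg, norm_of_mem_jmRoots hζ, one_mul,
      Real.log_div (norm_ne_zero_iff.mpr h2) (norm_ne_zero_iff.mpr h0), mul_sub]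
  rw [logSum, Finset.sum_congr rfl key, Finset.sum_sub_distrib, ← Finset.sum_mul, ha, zero_mul,
    sub_zero, logSum,
    ← sum_jmRoots_conj fun ζ => a (starRingEnd ℂ ζ) * Real.log ‖w - ζ‖]
  simp only [Complex.conj_conj]

/-- The exponents i + 1 and j + 1 add up to m + 1, so ζ^(j+1) is the conjugate of ζ^(i+1) and the
two expansions combine to real residues. Real residues are what makes the real part of the integral
single-valued. -/
lemma sum_re_mul_inv_sub {m i j : ℕ} (hij : i + j + 1 = m) {z : ℂ} (hz : z ^ (m + 1) ≠ 1) :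
    ∑ ζ ∈ jmRoots m, (((ζ ^ (i + 1)).re : ℝ) : ℂ) * (z - ζ)⁻¹
      = (m + 1) / 2 * ((z ^ i + z ^ j) / (z ^ (m + 1) - 1)) := by
  rw [add_div (z ^ i), mul_add, div_mul_eq_mul_div, div_mul_eq_mul_div, ← pow_div_eq_sum (by omega) hz,
    ← pow_div_eq_sum (by omega) hz, ← add_div, ← Finset.sum_add_distrib, Finset.sum_div]
  refine Finset.sum_congr rfl fun ζ hζ => ?_
  rw [Complex.re_eq_add_conj, conj_pow_of_mem_jmRoots hζ (show i + 1 + (j + 1) = m + 1 by omega)]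
  ring

lemma sum_im_mul_inv_sub {m i j : ℕ} (hij : i + j + 1 = m) {z : ℂ} (hz : z ^ (m + 1) ≠ 1) :
    ∑ ζ ∈ jmRoots m, (((ζ ^ (i + 1)).im : ℝ) : ℂ) * (z - ζ)⁻¹
      = (m + 1) / (2 * Complex.I) * ((z ^ i - z ^ j) / (z ^ (m + 1) - 1)) := by
  rw [sub_div, mul_sub, div_mul_eq_mul_div, div_mul_eq_mul_div, ← pow_div_eq_sum (by omega) hz,
    ← pow_div_eq_sum (by omega) hz, ← sub_div, ← Finset.sum_sub_distrib, Finset.sum_div]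
  refine Finset.sum_congr rfl fun ζ hζ => ?_
  rw [Complex.im_eq_sub_conj, conj_pow_of_mem_jmRoots hζ (show i + 1 + (j + 1) = m + 1 by omega)]
  ring

lemma sum_re_pow_jmRoots {m j : ℕ} (hj : 1 ≤ j) (hjm : j ≤ m) :
    ∑ ζ ∈ jmRoots m, (ζ ^ j).re = 0 := by
  rw [← Complex.re_sum, sum_pow_jmRoots hj hjm, Complex.zero_re]

lemma sum_im_pow_jmRoots {m j : ℕ} (hj : 1 ≤ j) (hjm : j ≤ m) :
    ∑ ζ ∈ jmRoots m, (ζ ^ j).im = 0 := by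
  rw [← Complex.im_sum, sum_pow_jmRoots hj hjm, Complex.zero_im]

lemma hasDerivAt_pow_div {m : ℕ} (q : ℕ) {z : ℂ} (hz : z ^ (m + 1) ≠ 1) :
    HasDerivAt (fun w : ℂ => w ^ q / (w ^ (m + 1) - 1))
      ((q * z ^ (q - 1) * (z ^ (m + 1) - 1) - z ^ q * ((m + 1) * z ^ m)) / (z ^ (m + 1) - 1) ^ 2)
      z := by
  have h := (hasDerivAt_pow q z).div ((hasDerivAt_pow (m + 1) z).sub_const 1) (sub_ne_zero.mpr hz)
  simpa only [Nat.add_sub_cancel, Nat.cast_add, Nat.cast_one, Pi.div_def] using h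

/-- The primitive of the real part of `jmG m j dz`. -/
def jmPrimG (m j : ℕ) (z : ℂ) : ℝ :=
  -(2 * (m - j) / (m + 1) ^ 2) * logSum m (fun ζ => (ζ ^ (j + 1)).re) z
    + (z ^ (m - j) / (z ^ (m + 1) - 1) - z ^ (j + 1) / (z ^ (m + 1) - 1)).re / (m + 1)

/-- The primitive of the real part of `jmH m j dz`. -/
def jmPrimH (m j : ℕ) (z : ℂ) : ℝ :=
  2 * (m - j) / (m + 1) ^ 2 * logSum m (fun ζ => (ζ ^ (j + 1)).im) z
    - (Complex.I * (z ^ (j + 1) / (z ^ (m + 1) - 1) + z ^ (m - j) / (z ^ (m + 1) - 1))).re / (m + 1)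

/-- The primitive of the real part of `2 √m z ^ m / (z ^ (m + 1) - 1) ^ 2 dz`. -/
def jmPrimLast (m : ℕ) (z : ℂ) : ℝ :=
  -(2 * Real.sqrt m / (m + 1)) * ((z ^ 0 / (z ^ (m + 1) - 1)).re + 1 / 2)

lemma hasFDerivAt_jmPrimG {m j : ℕ} (hj : j < m) {z : ℂ} (hz : z ^ (m + 1) ≠ 1) :
    HasFDerivAt (jmPrimG m j) (reDeriv (jmG m j z)) z := by
  obtain ⟨d, rfl⟩ := Nat.exists_eq_add_of_lt hj
  have h1 := (hasFDerivAt_logSum (fun ζ => (ζ ^ (j + 1)).re) hz).const_mul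
    -- Writing m = j + d + 1 removes the truncated subtractions from the exponents, so that the
    -- comparison of derivatives becomes an identity for `ring`.
    (-(2 * ((j + d + 1 : ℕ) - (j : ℝ)) / ((j + d + 1 : ℕ) + 1) ^ 2))
  have h2 := ((hasDerivAt_pow_div (j + d + 1 - j) hz).sub
    (hasDerivAt_pow_div (j + 1) hz)).hasFDerivAt_re.mul_const
      (((j + d + 1 : ℕ) + 1 : ℝ)⁻¹)
  refine (h1.add h2).congr_fderiv ?_
  rw [sum_re_mul_inv_sub rfl hz]
  have hP := sub_ne_zero.mpr hz
  have hd : j + d + 1 - j = d + 1 := by omega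
  have hd2 : 2 * (j + d + 1) - 2 * j = 2 * d + 2 := by omega
  ext v
  simp only [add_apply, smul_apply, reDeriv_apply,
    smul_eq_mul]
  rw [← Complex.re_ofReal_mul, ← Complex.re_ofReal_mul, ← Complex.add_re]
  congr 1
  have hm : ((j + d + 1 : ℕ) + 1 : ℂ) ≠ 0 := by
    exact_mod_cast Nat.succ_ne_zero (j + d + 1)
  rw [jmG, hd, hd2]
  push_cast at hm ⊢
  field_simp
  ring

lemma hasFDerivAt_jmPrimH {m j : ℕ} (hj : j < m) {z : ℂ} (hz : z ^ (m + 1) ≠ 1) :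
    HasFDerivAt (jmPrimH m j) (reDeriv (jmH m j z)) z := by
  obtain ⟨d, rfl⟩ := Nat.exists_eq_add_of_lt hj
  have h1 := (hasFDerivAt_logSum (fun ζ => (ζ ^ (j + 1)).im) hz).const_mul
    (2 * ((j + d + 1 : ℕ) - (j : ℝ)) / ((j + d + 1 : ℕ) + 1) ^ 2)
  have h2 := (((hasDerivAt_pow_div (j + 1) hz).add
    (hasDerivAt_pow_div (j + d + 1 - j) hz)).const_mul Complex.I).hasFDerivAt_re.mul_const
      (((j + d + 1 : ℕ) + 1 : ℝ)⁻¹)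
  refine (h1.sub h2).congr_fderiv ?_
  rw [sum_im_mul_inv_sub rfl hz]
  have hP := sub_ne_zero.mpr hz
  have hd : j + d + 1 - j = d + 1 := by omega
  have hd2 : 2 * (j + d + 1) - 2 * j = 2 * d + 2 := by omega
  ext v
  simp only [sub_apply, smul_apply, reDeriv_apply,
    smul_eq_mul]
  rw [← Complex.re_ofReal_mul, ← Complex.re_ofReal_mul, ← Complex.sub_re]
  congr 1
  have hm : ((j + d + 1 : ℕ) + 1 : ℂ) ≠ 0 := by
    exact_mod_cast Nat.succ_ne_zero (j + d + 1)
  rw [jmH, hd, hd2, div_eq_mul_inv _ (2 * Complex.I), mul_inv, Complex.inv_I]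
  push_cast at hm ⊢
  field_simp
  ring

lemma hasFDerivAt_jmPrimLast {m : ℕ} {z : ℂ} (hz : z ^ (m + 1) ≠ 1) :
    HasFDerivAt (jmPrimLast m)
      (reDeriv (2 * (Real.sqrt m : ℂ) * z ^ m / (z ^ (m + 1) - 1) ^ 2)) z := by
  have h1 := ((hasDerivAt_pow_div 0 hz).hasFDerivAt_re.add_const (1 / 2)).const_mul
    (-(2 * Real.sqrt m / (m + 1)))
  refine h1.congr_fderiv ?_
  have hP := sub_ne_zero.mpr hz
  ext v
  simp only [smul_apply, reDeriv_apply, smul_eq_mul]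
  rw [← Complex.re_ofReal_mul]
  congr 1
  have hm : (m + 1 : ℂ) ≠ 0 := by exact_mod_cast m.succ_ne_zero
  push_cast
  field_simp
  ring

lemma inv_pow_div {m : ℕ} {w : ℂ} (h0 : w ≠ 0) (hw : w ^ (m + 1) ≠ 1) {i j : ℕ}
    (hij : i + j = m + 1) :
    w⁻¹ ^ i / (w⁻¹ ^ (m + 1) - 1) = -(w ^ j / (w ^ (m + 1) - 1)) := by
  have hP := sub_ne_zero.mpr hw
  have hP' : 1 - w ^ (m + 1) ≠ 0 := sub_ne_zero.mpr hw.symm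
  rw [inv_pow, inv_pow, ← hij] at *
  have : (w ^ (i + j))⁻¹ - 1 = (1 - w ^ (i + j)) / w ^ (i + j) := by
    field_simp
  rw [this, ← neg_sub 1 (w ^ (i + j)), div_neg, neg_neg]
  field_simp
  ring

lemma jmPrimG_inv {m j : ℕ} (hj : j < m) {w : ℂ} (h0 : w ≠ 0) (hw : w ^ (m + 1) ≠ 1) :
    jmPrimG m j w⁻¹ = jmPrimG m j w := by
  rw [jmPrimG, jmPrimG, logSum_inv _ h0 hw (sum_re_pow_jmRoots (by omega) hj),
    inv_pow_div h0 hw (show m - j + (j + 1) = m + 1 by omega),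
    inv_pow_div h0 hw (show j + 1 + (m - j) = m + 1 by omega)]
  simp only [← map_pow (starRingEnd ℂ), Complex.conj_re]
  rw [neg_sub_neg]

lemma jmPrimH_inv {m j : ℕ} (hj : j < m) {w : ℂ} (h0 : w ≠ 0) (hw : w ^ (m + 1) ≠ 1) :
    jmPrimH m j w⁻¹ = -jmPrimH m j w := by
  rw [jmPrimH, jmPrimH, logSum_inv _ h0 hw (sum_im_pow_jmRoots (by omega) hj),
    inv_pow_div h0 hw (show m - j + (j + 1) = m + 1 by omega),
    inv_pow_div h0 hw (show j + 1 + (m - j) = m + 1 by omega)]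
  have : logSum m (fun ζ => (starRingEnd ℂ ζ ^ (j + 1)).im) w
      = -logSum m (fun ζ => (ζ ^ (j + 1)).im) w := by
    simp only [logSum, ← map_pow (starRingEnd ℂ), Complex.conj_im, neg_mul,
      Finset.sum_neg_distrib]
  rw [this, ← neg_add, mul_neg, mul_neg, Complex.neg_re, add_comm (w ^ (m - j) / _)]
  ring

/-- Inversion sends 1/P to -1 - 1/P. The constant 1/2 in the primitive is chosen to turn this into a
change of sign. -/
lemma jmPrimLast_inv {m : ℕ} {w : ℂ} (h0 : w ≠ 0) (hw : w ^ (m + 1) ≠ 1) :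
    jmPrimLast m w⁻¹ = -jmPrimLast m w := by
  have hP := sub_ne_zero.mpr hw
  have h1 : w ^ (m + 1) / (w ^ (m + 1) - 1) = 1 + w ^ 0 / (w ^ (m + 1) - 1) := by
    field_simp
    ring
  rw [jmPrimLast, jmPrimLast, inv_pow_div h0 hw (zero_add _), h1, Complex.neg_re, Complex.add_re,
    Complex.one_re]
  ring

/-! ### The surface -/

/-- The value `g j` at the index `2 j`, `h j` at the index `2 j + 1`, and `l` at the index `2 m`. -/
def jmCases {E : Type*} (m : ℕ) (g h : ℕ → E) (l : E) (k : ℕ) : E :=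
  if k = 2 * m then l else if k % 2 = 0 then g (k / 2) else h (k / 2)

lemma jmCases_induction {m : ℕ} {p : ℕ → Prop} (hg : ∀ j < m, p (2 * j))
    (hh : ∀ j < m, p (2 * j + 1)) (hl : p (2 * m)) (k : Fin (2 * m + 1)) : p k := by
  obtain ⟨k, hk⟩ := k
  change p k
  rcases Nat.even_or_odd' k with ⟨j, rfl | rfl⟩
  · rcases lt_or_eq_of_le (show j ≤ m by omega) with h | rfl
    · exact hg j h
    · exact hl
  · exact hh j (by omega)

section
variable {E : Type*} {m : ℕ} (g h : ℕ → E) (l : E)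

lemma jmCases_last : jmCases m g h l (2 * m) = l := if_pos rfl

lemma jmCases_even {j : ℕ} (hj : j < m) : jmCases m g h l (2 * j) = g j := by
  rw [jmCases, if_neg (by omega), if_pos (by omega), show 2 * j / 2 = j by omega]

lemma jmCases_odd (j : ℕ) : jmCases m g h l (2 * j + 1) = h j := by
  rw [jmCases, if_neg (by omega), if_neg (by omega), show (2 * j + 1) / 2 = j by omega]

end

lemma jmData_eq (m : ℕ) (z : ℂ) (k : Fin (2 * m + 1)) :
    jmData m z k = jmCases m (fun j => jmG m j z) (fun j => jmH m j z)
      (2 * (Real.sqrt m : ℂ) * z ^ m / (z ^ (m + 1) - 1) ^ 2) k := rfl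

lemma sum_fin_two_mul_add_one {E : Type*} [AddCommMonoid E] (m : ℕ) (T : ℕ → E) :
    ∑ k : Fin (2 * m + 1), T k = ∑ j ∈ Finset.range m, (T (2 * j) + T (2 * j + 1)) + T (2 * m) := by
  rw [← Finset.sum_range, Finset.sum_range_succ]
  congr 1
  induction m with
  | zero => simp
  | succ m ih =>
    rw [Finset.sum_range_succ, ← ih, mul_add, mul_one, Finset.sum_range_succ, Finset.sum_range_succ,
      add_assoc]

lemma sum_jmData {E : Type*} [AddCommMonoid E] (m : ℕ) (z : ℂ) (Φ : ℕ → ℂ → E) :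
    ∑ k : Fin (2 * m + 1), Φ k (jmData m z k)
      = ∑ j ∈ Finset.range m, (Φ (2 * j) (jmG m j z) + Φ (2 * j + 1) (jmH m j z))
        + Φ (2 * m) (2 * (Real.sqrt m : ℂ) * z ^ m / (z ^ (m + 1) - 1) ^ 2) := by
  simp only [jmData_eq]
  rw [sum_fin_two_mul_add_one m fun k => Φ k (jmCases m (fun j => jmG m j z) (fun j => jmH m j z)
      (2 * (Real.sqrt m : ℂ) * z ^ m / (z ^ (m + 1) - 1) ^ 2) k), jmCases_last]
  congr 1
  refine Finset.sum_congr rfl fun j hj => ?_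
  rw [jmCases_even _ _ _ (Finset.mem_range.mp hj), jmCases_odd]

lemma sum_jmData_sq (m : ℕ) {z : ℂ} (hz : z ^ (m + 1) ≠ 1) : ∑ k, jmData m z k ^ 2 = 0 := by
  have hP := sub_ne_zero.mpr hz
  -- From (1 - x)² - (1 + x)² = -4x with x = z^(2m-2j), every pair contributes the same amount,
  -- independent of j.
  have key : ∀ j ∈ Finset.range m,
      jmG m j z ^ 2 + jmH m j z ^ 2 = -(4 * z ^ (2 * m) / (z ^ (m + 1) - 1) ^ 4) := by
    intro j hj
    obtain ⟨d, rfl⟩ := Nat.exists_eq_add_of_lt (Finset.mem_range.mp hj)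
    rw [jmG, jmH, show 2 * (j + d + 1) - 2 * j = 2 * d + 2 by omega]
    field_simp
    rw [Complex.I_sq]
    ring
  have hsq : (Real.sqrt m : ℂ) ^ 2 = m := by
    rw [← Complex.ofReal_pow, Real.sq_sqrt m.cast_nonneg, Complex.ofReal_natCast]
  rw [sum_jmData m z fun _ c => c ^ 2, Finset.sum_congr rfl key, Finset.sum_const,
    Finset.card_range, nsmul_eq_mul, div_pow, mul_pow, mul_pow, hsq]
  field_simp
  ring

/-- The coefficients of `jmPoly`. -/
def jmCoeff (m i : ℕ) : ℝ := if i = m then 2 * m else 1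

/-- The polynomial `1 + r + ⋯ + r ^ (2 m) + (2 m - 1) r ^ m`. -/
def jmPoly (m : ℕ) (r : ℝ) : ℝ := ∑ i ∈ Finset.range (2 * m + 1), jmCoeff m i * r ^ i

lemma jmCoeff_nonneg (m i : ℕ) : 0 ≤ jmCoeff m i := by
  rw [jmCoeff]
  split_ifs <;> positivity

lemma one_le_jmCoeff {m : ℕ} (hm : 1 ≤ m) (i : ℕ) : 1 ≤ jmCoeff m i := by
  rw [jmCoeff]
  have : (1 : ℝ) ≤ m := by exact_mod_cast hm
  split_ifs <;> linarith

lemma sum_range_two_mul_add_one {E : Type*} [AddCommMonoid E] (m : ℕ) (T : ℕ → E) :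
    ∑ i ∈ Finset.range (2 * m + 1), T i
      = ∑ j ∈ Finset.range m, (T j + T (2 * m - j)) + T m := by
  rw [show 2 * m + 1 = m + 1 + m by omega, Finset.sum_range_add, Finset.sum_range_succ,
    Finset.sum_add_distrib, add_right_comm,
    ← Finset.sum_range_reflect fun j => T (2 * m - j)]
  congr 2
  refine Finset.sum_congr rfl fun j hj => ?_
  have := Finset.mem_range.mp hj
  congr 1
  omega

lemma pow_le_jmPoly {m : ℕ} (hm : 1 ≤ m) {r : ℝ} (hr : 0 ≤ r) {i : ℕ} (hi : i ≤ 2 * m) :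
    r ^ i ≤ jmPoly m r := by
  refine le_trans ?_ (Finset.single_le_sum (f := fun i => jmCoeff m i * r ^ i)
    (fun j _ => mul_nonneg (jmCoeff_nonneg m j) (pow_nonneg hr j))
    (Finset.mem_range.mpr (Nat.lt_succ_of_le hi)))
  exact le_mul_of_one_le_left (pow_nonneg hr i) (one_le_jmCoeff hm i)

lemma jmPoly_pos {m : ℕ} (hm : 1 ≤ m) {r : ℝ} (hr : 0 ≤ r) : 0 < jmPoly m r :=
  one_pos.trans_le (by simpa using pow_le_jmPoly hm hr (Nat.zero_le _))

/-- The parallelogram law for 1 and z^(2m-2j) removes the mixed terms, so each pair yields the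
powers j and 2m - j of |z|². The last entry yields the middle coefficient 2m of `jmPoly`. -/
lemma sum_norm_jmData_sq {m : ℕ} {z : ℂ} (hz : z ^ (m + 1) ≠ 1) :
    (∑ k, ‖jmData m z k‖ ^ 2) / 2 = jmPoly m (‖z‖ ^ 2) / ‖z ^ (m + 1) - 1‖ ^ 4 := by
  have hP := norm_ne_zero_iff.mpr (sub_ne_zero.mpr hz)
  have key : ∀ j ∈ Finset.range m, ‖jmG m j z‖ ^ 2 + ‖jmH m j z‖ ^ 2
      = 2 * ((‖z‖ ^ 2) ^ j + (‖z‖ ^ 2) ^ (2 * m - j)) / ‖z ^ (m + 1) - 1‖ ^ 4 := by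
    intro j hj
    obtain ⟨d, rfl⟩ := Nat.exists_eq_add_of_lt (Finset.mem_range.mp hj)
    have h1 := parallelogram_law_with_norm ℝ (1 : ℂ) (z ^ (2 * d + 2))
    rw [norm_one, norm_pow] at h1
    rw [jmG, jmH, show 2 * (j + d + 1) - 2 * j = 2 * d + 2 by omega,
      show 2 * (j + d + 1) - j = j + 2 * d + 2 by omega]
    simp only [norm_div, norm_mul, norm_pow, Complex.norm_I, one_mul, div_pow, mul_pow]
    rw [← add_div, ← mul_add, show ‖1 - z ^ (2 * d + 2)‖ ^ 2 + ‖1 + z ^ (2 * d + 2)‖ ^ 2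
      = 2 * (1 + (‖z‖ ^ (2 * d + 2)) ^ 2) by linear_combination h1]
    congr 1 <;> ring
  have hlast : ‖2 * (Real.sqrt m : ℂ) * z ^ m / (z ^ (m + 1) - 1) ^ 2‖ ^ 2
      = 2 * (2 * m * (‖z‖ ^ 2) ^ m) / ‖z ^ (m + 1) - 1‖ ^ 4 := by
    simp only [norm_div, norm_mul, norm_pow, Complex.norm_real, Real.norm_eq_abs, div_pow, mul_pow,
      sq_abs, Real.sq_sqrt (Nat.cast_nonneg (α := ℝ) m), Complex.norm_ofNat]
    congr 1 <;> ring
  rw [sum_jmData m z fun _ c => ‖c‖ ^ 2, Finset.sum_congr rfl key, hlast, ← Finset.sum_div,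
    ← Finset.mul_sum, ← add_div, ← mul_add, mul_div_assoc, mul_div_cancel_left₀ _ two_ne_zero]
  congr 1
  rw [jmPoly, sum_range_two_mul_add_one]
  congr 1
  · refine Finset.sum_congr rfl fun j hj => ?_
    have := Finset.mem_range.mp hj
    rw [jmCoeff, jmCoeff, if_neg (by omega), if_neg (by omega), one_mul, one_mul]
  · rw [jmCoeff, if_pos rfl]

/-- The real part of the integral of the Weierstrass data, normalized to be compatible with the
inversion `z ↦ 1 / z`. -/
def jmPrim (m : ℕ) (z : ℂ) (k : ℕ) : ℝ :=
  jmCases m (fun j => jmPrimG m j z) (fun j => jmPrimH m j z) (jmPrimLast m z) k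

/-- The sign by which the inversion `z ↦ 1 / z` changes a component of the surface. -/
def jmSign (m k : ℕ) : ℝ := jmCases m (fun _ => 1) (fun _ => -1) (-1) k

lemma hasFDerivAt_jmPrim {m : ℕ} {z : ℂ} (hz : z ^ (m + 1) ≠ 1) (k : Fin (2 * m + 1)) :
    HasFDerivAt (fun w => jmPrim m w k) (reDeriv (jmData m z k)) z := by
  rw [jmData_eq]
  simp only [jmPrim]
  refine jmCases_induction (p := fun k => HasFDerivAt (fun w => jmCases m (fun j => jmPrimG m j w)
    (fun j => jmPrimH m j w) (jmPrimLast m w) k) (reDeriv (jmCases m _ _ _ k)) z) ?_ ?_ ?_ k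
  · intro j hj
    simp only [jmCases_even _ _ _ hj]
    exact hasFDerivAt_jmPrimG hj hz
  · intro j hj
    simp only [jmCases_odd]
    exact hasFDerivAt_jmPrimH hj hz
  · simp only [jmCases_last]
    exact hasFDerivAt_jmPrimLast hz

lemma jmPrim_inv {m : ℕ} {w : ℂ} (h0 : w ≠ 0) (hw : w ^ (m + 1) ≠ 1) (k : Fin (2 * m + 1)) :
    jmPrim m w⁻¹ k = jmSign m k * jmPrim m w k := by
  simp only [jmPrim, jmSign]
  refine jmCases_induction (p := fun k => jmCases m _ _ _ k = jmCases m _ _ _ k * jmCases m _ _ _ k)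
    ?_ ?_ ?_ k
  · intro j hj
    simp only [jmCases_even _ _ _ hj]
    rw [jmPrimG_inv hj h0 hw, one_mul]
  · intro j hj
    simp only [jmCases_odd]
    rw [jmPrimH_inv hj h0 hw, neg_one_mul]
  · simp only [jmCases_last]
    rw [jmPrimLast_inv h0 hw, neg_one_mul]

lemma jmSign_sq (m k : ℕ) : jmSign m k ^ 2 = 1 := by
  rw [jmSign, jmCases]
  split_ifs <;> norm_num

/-- The surface, based at `z₀`. -/
def jmSurface (m : ℕ) (z₀ : ℂ) (p : RSphere) : EuclideanSpace ℝ (Fin (2 * m + 1)) :=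
  WithLp.toLp 2 fun k => OnePoint.elim p (jmSign m k * jmPrim m 0 k) (fun z => jmPrim m z k)
    - jmPrim m z₀ k

lemma jmSurface_paramZero (m : ℕ) (z₀ z : ℂ) (k : Fin (2 * m + 1)) :
    jmSurface m z₀ (paramZero z) k = jmPrim m z k - jmPrim m z₀ k := rfl

/-- Near ∞ the surface is, up to signs of the coordinates and a translation, the primitive itself at
w. This includes w = 0, by the value given to the surface at ∞, and yields the smooth extension. -/
lemma jmSurface_paramInfty {m : ℕ} (z₀ : ℂ) {w : ℂ} (hw : w ^ (m + 1) ≠ 1)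
    (k : Fin (2 * m + 1)) :
    jmSurface m z₀ (paramInfty w) k = jmSign m k * jmPrim m w k - jmPrim m z₀ k := by
  by_cases h0 : w = 0
  · rw [paramInfty, if_pos h0, h0]
    rfl
  · rw [paramInfty, if_neg h0, ← jmPrim_inv h0 hw]
    rfl

/-- The set of the complex numbers that are not `(m+1)`-th roots of unity: the coordinate
expression of `jmDomain m` in both parametrizations. -/
def jmPlane (m : ℕ) : Set ℂ := {z | z ^ (m + 1) ≠ 1}

lemma isOpen_jmPlane (m : ℕ) : IsOpen (jmPlane m) :=
  isOpen_ne_fun (by fun_prop) continuous_const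

lemma paramZero_mem_jmDomain {m : ℕ} {z : ℂ} : paramZero z ∈ jmDomain m ↔ z ^ (m + 1) ≠ 1 := by
  rw [jmDomain, Set.mem_compl_iff, not_iff_not]
  exact OnePoint.coe_injective.mem_set_image

lemma paramInfty_mem_jmDomain {m : ℕ} {w : ℂ} : paramInfty w ∈ jmDomain m ↔ w ^ (m + 1) ≠ 1 := by
  by_cases h0 : w = 0
  · rw [paramInfty, if_pos h0, h0]
    refine iff_of_true ?_ (by simp)
    rintro ⟨z, -, hz⟩
    exact OnePoint.coe_ne_infty z hz
  · rw [paramInfty, if_neg h0]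
    change paramZero w⁻¹ ∈ _ ↔ _
    rw [paramZero_mem_jmDomain, inv_pow, Ne, inv_eq_one]

lemma IsParam.mem_jmDomain {m : ℕ} {σ : ℂ → RSphere} (hσ : IsParam σ) {z : ℂ} :
    σ z ∈ jmDomain m ↔ z ∈ jmPlane m := by
  rcases hσ with rfl | rfl
  · exact paramZero_mem_jmDomain
  · exact paramInfty_mem_jmDomain

lemma IsParam.preimage_jmDomain {m : ℕ} {σ : ℂ → RSphere} (hσ : IsParam σ) :
    σ ⁻¹' jmDomain m = jmPlane m :=
  Set.ext fun _ => hσ.mem_jmDomain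

lemma jmSurface_param {m : ℕ} (z₀ : ℂ) {σ : ℂ → RSphere} (hσ : IsParam σ) :
    ∃ s : Fin (2 * m + 1) → ℝ, (∀ k, s k ^ 2 = 1) ∧
      ∀ z ∈ jmPlane m, ∀ k, jmSurface m z₀ (σ z) k = s k * jmPrim m z k - jmPrim m z₀ k := by
  rcases hσ with rfl | rfl
  · exact ⟨fun _ => 1, fun _ => one_pow 2, fun z _ k => by rw [jmSurface_paramZero, one_mul]⟩
  · exact ⟨fun k => jmSign m k, fun k => jmSign_sq m k, fun z hz k => jmSurface_paramInfty z₀ hz k⟩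

lemma differentiableOn_jmData (m : ℕ) (k : Fin (2 * m + 1)) :
    DifferentiableOn ℂ (fun z => jmData m z k) (jmPlane m) := by
  intro z hz
  have hP : (z ^ (m + 1) - 1) ^ 2 ≠ 0 := pow_ne_zero _ (sub_ne_zero.mpr hz)
  refine DifferentiableAt.differentiableWithinAt ?_
  unfold jmData jmG jmH
  split_ifs <;> fun_prop (disch := assumption)

/-- Signs change neither the squares nor the norms of the entries, so both charts are treated at
once. -/
lemma isWeierstrassOn_of_sign {m : ℕ} (hm : 1 ≤ m) (z₀ : ℂ) {σ : ℂ → RSphere}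
    {s : Fin (2 * m + 1) → ℝ} (hs : ∀ k, s k ^ 2 = 1)
    (h : ∀ z ∈ jmPlane m, ∀ k, jmSurface m z₀ (σ z) k = s k * jmPrim m z k - jmPrim m z₀ k) :
    IsWeierstrassOn (jmSurface m z₀ ∘ σ) (fun z k => s k * jmData m z k) (jmPlane m) where
  isOpen := isOpen_jmPlane m
  hasFDerivAt z hz := by
    refine hasFDerivAt_weierstrassDeriv fun k => ?_
    have h1 := ((hasFDerivAt_jmPrim hz k).const_mul (s k)).sub_const (jmPrim m z₀ k)
    refine (h1.congr_fderiv ?_).congr_of_eventuallyEq ?_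
    · ext v
      rw [smul_apply, reDeriv_apply, reDeriv_apply, smul_eq_mul,
        mul_left_comm, Complex.re_ofReal_mul]
    · filter_upwards [(isOpen_jmPlane m).mem_nhds hz] with w hw using h w hw k
  holomorphic := differentiableOn_pi.mpr fun k => (differentiableOn_jmData m k).const_mul _
  isotropic z hz := by
    rw [← sum_jmData_sq m hz]
    refine Finset.sum_congr rfl fun k _ => ?_
    rw [mul_pow, ← Complex.ofReal_pow, hs, Complex.ofReal_one, one_mul]
  ne_zero z hz h0 := by
    have h1 := sum_norm_jmData_sq hz
    have h2 : ∀ k, jmData m z k = 0 := fun k => by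
      have h3 : (s k : ℂ) * jmData m z k = 0 := congrFun h0 k
      refine (mul_eq_zero.mp h3).resolve_left fun h4 => ?_
      have h5 := hs k
      rw [Complex.ofReal_eq_zero.mp h4] at h5
      norm_num at h5
    simp only [h2] at h1
    have h3 := jmPoly_pos hm (sq_nonneg ‖z‖)
    have h4 := norm_pos_iff.mpr (sub_ne_zero.mpr (show z ^ (m + 1) ≠ 1 from hz))
    have : 0 < jmPoly m (‖z‖ ^ 2) / ‖z ^ (m + 1) - 1‖ ^ 4 := by positivity
    rw [← h1] at this
    simp at this

lemma isWeierstrassOn_jmSurface {m : ℕ} (hm : 1 ≤ m) (z₀ : ℂ) :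
    IsWeierstrassOn (jmSurface m z₀ ∘ paramZero) (jmData m) (jmPlane m) := by
  have := isWeierstrassOn_of_sign hm z₀ (σ := paramZero) (s := fun _ => 1) (by simp)
    fun z _ k => by rw [jmSurface_paramZero, one_mul]
  simpa using this

lemma isConformalMinimalImmersion_jmSurface {m : ℕ} (hm : 1 ≤ m) (z₀ : ℂ) :
    IsConformalMinimalImmersion (jmSurface m z₀) (jmDomain m) := by
  intro σ hσ
  obtain ⟨s, hs, h⟩ := jmSurface_param z₀ hσ
  rw [hσ.preimage_jmDomain]
  exact (isWeierstrassOn_of_sign hm z₀ hs h).isConformalMinimalOn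

lemma norm_fderiv_jmSurface {m : ℕ} (hm : 1 ≤ m) (z₀ : ℂ) {σ : ℂ → RSphere} (hσ : IsParam σ)
    {z : ℂ} (hz : z ∈ jmPlane m) (v : ℂ) :
    ‖fderiv ℝ (jmSurface m z₀ ∘ σ) z v‖
      = ‖v‖ * (Real.sqrt (jmPoly m (‖z‖ ^ 2)) / ‖z ^ (m + 1) - 1‖ ^ 2) := by
  obtain ⟨s, hs, h⟩ := jmSurface_param z₀ hσ
  have hW := isWeierstrassOn_of_sign hm z₀ hs h
  rw [(hW.hasFDerivAt z hz).fderiv, norm_weierstrassDeriv (hW.isotropic z hz)]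
  have : ∀ k, ‖(s k : ℂ) * jmData m z k‖ ^ 2 = ‖jmData m z k‖ ^ 2 := fun k => by
    rw [norm_mul, mul_pow, Complex.norm_real, Real.norm_eq_abs, sq_abs, hs, one_mul]
  simp only [this]
  rw [sum_norm_jmData_sq hz, Real.sqrt_div' _ (by positivity),
    show ‖z ^ (m + 1) - 1‖ ^ 4 = (‖z ^ (m + 1) - 1‖ ^ 2) ^ 2 by ring, Real.sqrt_sq (by positivity)]

/-! ### The total curvature -/

-- The second derivative of L(|w|²) in the direction e is 2 L₁ |e|² + 4 L₂ ⟨z, e⟩². The directions 1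
-- and i are summed with ⟨z, 1⟩² + ⟨z, i⟩² = |z|².
open Laplacian InnerProductSpace in
lemma laplacian_comp_norm_sq {L L₁ : ℝ → ℝ} {L₂ : ℝ} {z : ℂ}
    (h₁ : ∀ r, 0 ≤ r → HasDerivAt L (L₁ r) r) (h₂ : HasDerivAt L₁ L₂ (‖z‖ ^ 2)) :
    Δ (fun w : ℂ => L (‖w‖ ^ 2)) z = 4 * (L₁ (‖z‖ ^ 2) + ‖z‖ ^ 2 * L₂) := by
  have hsq : ∀ w : ℂ, HasFDerivAt (fun w : ℂ => ‖w‖ ^ 2) ((2 : ℝ) • innerSL ℝ w) w :=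
    fun w => (hasStrictFDerivAt_norm_sq w).hasFDerivAt.congr_fderiv (by rw [two_smul, two_smul])
  have hf : fderiv ℝ (fun w : ℂ => L (‖w‖ ^ 2)) = fun w => L₁ (‖w‖ ^ 2) • ((2 : ℝ) • innerSL ℝ w) := by
    funext w
    exact ((h₁ _ (sq_nonneg _)).comp_hasFDerivAt w (hsq w)).fderiv
  have hf2 := (h₂.comp_hasFDerivAt z (hsq z)).smul
    ((innerSL ℝ (E := ℂ)).hasFDerivAt (x := z) |>.const_smul (2 : ℝ))
  have hre := Complex.sq_norm z
  rw [Complex.normSq_apply] at hre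
  rw [laplacian_eq_iteratedFDeriv_complexPlane]
  simp only [iteratedFDeriv_two_apply, hf]
  have hf3 : fderiv ℝ (fun w : ℂ => L₁ (‖w‖ ^ 2) • ((2 : ℝ) • innerSL ℝ w)) z = _ := hf2.fderiv
  rw [hf3]
  change (L₁ (‖z‖ ^ 2) * (2 * inner ℝ (1 : ℂ) 1) + L₂ * (2 * inner ℝ z 1) * (2 * inner ℝ z 1))
    + (L₁ (‖z‖ ^ 2) * (2 * inner ℝ Complex.I Complex.I)
      + L₂ * (2 * inner ℝ z Complex.I) * (2 * inner ℝ z Complex.I)) = _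
  simp only [Complex.inner]
  simp
  linear_combination (-4 * L₂) * hre

/-! ### Logarithmic convexity and growth of polynomials with nonnegative coefficients -/

lemma Polynomial.coeff_X_mul_derivative {R : Type*} [CommSemiring R] (p : Polynomial R) (i : ℕ) :
    (Polynomial.X * Polynomial.derivative p).coeff i = i * p.coeff i := by
  cases i with
  | zero => simp
  | succ i =>
    rw [Polynomial.coeff_X_mul, Polynomial.coeff_derivative, mul_comm]
    push_cast
    rfl

lemma Polynomial.natDegree_X_mul_derivative_le {R : Type*} [CommSemiring R] (p : Polynomial R) :
    (Polynomial.X * Polynomial.derivative p).natDegree ≤ p.natDegree := by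
  refine Polynomial.natDegree_le_iff_coeff_eq_zero.mpr fun i hi => ?_
  rw [coeff_X_mul_derivative, Polynomial.coeff_eq_zero_of_natDegree_lt hi, mul_zero]

/-- Cauchy–Schwarz with the weights q_i r^i: (Σ i q_i r^i)² ≤ (Σ i² q_i r^i)(Σ q_i r^i).
Equivalently, log Q(e^t) is convex in t. -/
lemma sq_eval_X_mul_derivative_le {Q : Polynomial ℝ} (h0 : ∀ i, 0 ≤ Q.coeff i) {r : ℝ}
    (hr : 0 ≤ r) :
    (Polynomial.X * Polynomial.derivative Q).eval r ^ 2
      ≤ (Polynomial.X * Polynomial.derivative (Polynomial.X * Polynomial.derivative Q)).eval r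
        * Q.eval r := by
  have hd := Polynomial.natDegree_X_mul_derivative_le Q
  rw [Polynomial.eval_eq_sum_range' (Nat.lt_succ_of_le hd),
    Polynomial.eval_eq_sum_range' (Nat.lt_succ_of_le
      ((Polynomial.natDegree_X_mul_derivative_le _).trans hd)),
    Polynomial.eval_eq_sum_range' (Nat.lt_succ_self Q.natDegree)]
  simp only [Polynomial.coeff_X_mul_derivative]
  refine Finset.sum_sq_le_sum_mul_sum_of_sq_le_mul _ (fun i _ => ?_) (fun i _ => ?_)
    fun i _ => le_of_eq (by ring)
  · have := h0 i
    positivity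
  · have := h0 i
    positivity

lemma eval_pos_of_coeff_nonneg {Q : Polynomial ℝ} (h0 : ∀ i, 0 ≤ Q.coeff i)
    (hpos : 0 < Q.coeff 0) {r : ℝ} (hr : 0 ≤ r) : 0 < Q.eval r := by
  rw [Polynomial.eval_eq_sum_range]
  refine Finset.sum_pos' (fun i _ => mul_nonneg (h0 i) (pow_nonneg hr i))
    ⟨0, Finset.mem_range.mpr (Nat.succ_pos _), by simpa using hpos⟩

lemma tendsto_eval_X_mul_derivative_div {Q : Polynomial ℝ} (hQ : Q ≠ 0) :
    Filter.Tendsto (fun r => (Polynomial.X * Polynomial.derivative Q).eval r / Q.eval r)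
      Filter.atTop (nhds Q.natDegree) := by
  rcases Nat.eq_zero_or_pos Q.natDegree with h | h
  · rw [h, Polynomial.eq_C_of_natDegree_eq_zero h]
    simp
  · have hlead : (Polynomial.X * Polynomial.derivative Q).coeff Q.natDegree ≠ 0 := by
      rw [Polynomial.coeff_X_mul_derivative]
      exact mul_ne_zero (by exact_mod_cast h.ne') (Polynomial.leadingCoeff_ne_zero.mpr hQ)
    have hdeg : (Polynomial.X * Polynomial.derivative Q).natDegree = Q.natDegree :=
      le_antisymm (Polynomial.natDegree_X_mul_derivative_le Q)
        (Polynomial.le_natDegree_of_ne_zero hlead)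
    have h1 := Polynomial.div_tendsto_atTop_leadingCoeff_div_of_degree_eq
      (Polynomial.X * Polynomial.derivative Q) Q (by
        rw [Polynomial.degree_eq_natDegree (fun h2 => hlead (by rw [h2, Polynomial.coeff_zero])),
          Polynomial.degree_eq_natDegree hQ, hdeg])
    rwa [Polynomial.leadingCoeff, hdeg, Polynomial.coeff_X_mul_derivative,
      Polynomial.coeff_natDegree, mul_div_cancel_right₀ _ (Polynomial.leadingCoeff_ne_zero.mpr hQ)] at h1

/-- In polar coordinates the radial Laplacian times y is an exact derivative, so its integral only
needs the limits of the primitive 2 y² L₁(y²) at 0 and ∞. -/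
lemma hasDerivAt_mul_comp_sq {L₁ L₂ : ℝ → ℝ} {y : ℝ} (h : HasDerivAt L₁ (L₂ (y ^ 2)) (y ^ 2)) :
    HasDerivAt (fun y => 2 * (y ^ 2 * L₁ (y ^ 2)))
      (y * (4 * (L₁ (y ^ 2) + y ^ 2 * L₂ (y ^ 2)))) y := by
  have h1 : HasDerivAt (fun y : ℝ => y ^ 2) (2 * y) y := by simpa using hasDerivAt_pow 2 y
  have h2 := (h1.mul (HasDerivAt.comp (h := fun y : ℝ => y ^ 2) y h h1)).const_mul 2
  refine h2.congr_deriv ?_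
  simp only [Function.comp]
  ring

/-- The derivative of the logarithmic derivative of `Q`. -/
def logDeriv₂ (Q : Polynomial ℝ) (r : ℝ) : ℝ :=
  (Q.derivative.derivative.eval r * Q.eval r - Q.derivative.eval r * Q.derivative.eval r)
    / Q.eval r ^ 2

lemma logDeriv₂_nonneg {Q : Polynomial ℝ} (h0 : ∀ i, 0 ≤ Q.coeff i) (hpos : 0 < Q.coeff 0) {r : ℝ}
    (hr : 0 < r) : 0 ≤ Q.derivative.eval r / Q.eval r + r * logDeriv₂ Q r := by
  have h1 := sq_eval_X_mul_derivative_le h0 hr.le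
  simp only [Polynomial.eval_mul, Polynomial.eval_X, Polynomial.derivative_mul,
    Polynomial.derivative_X, one_mul, Polynomial.eval_add] at h1
  have hp := eval_pos_of_coeff_nonneg h0 hpos hr.le
  have h2 : Q.derivative.eval r / Q.eval r + r * logDeriv₂ Q r
      = (r * (Q.derivative.eval r + r * Q.derivative.derivative.eval r) * Q.eval r
        - (r * Q.derivative.eval r) ^ 2) / (r * Q.eval r ^ 2) := by
    rw [logDeriv₂]
    field_simp
    ring
  rw [h2]
  exact div_nonneg (sub_nonneg.mpr h1) (by positivity)

lemma integral_laplacian_log_eval {Q : Polynomial ℝ} (h0 : ∀ i, 0 ≤ Q.coeff i)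
    (hpos : 0 < Q.coeff 0) :
    MeasureTheory.Integrable
        (Laplacian.laplacian fun w : ℂ => Real.log (Q.eval (‖w‖ ^ 2))) ∧
      ∫ z : ℂ, Laplacian.laplacian (fun w : ℂ => Real.log (Q.eval (‖w‖ ^ 2))) z
        = 4 * Real.pi * Q.natDegree := by
  have hp : ∀ r, 0 ≤ r → 0 < Q.eval r := fun r hr => eval_pos_of_coeff_nonneg h0 hpos hr
  obtain ⟨L₁, hL₁⟩ : ∃ L₁ : ℝ → ℝ, L₁ = fun r => Q.derivative.eval r / Q.eval r := ⟨_, rfl⟩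
  have hL : ∀ r, 0 ≤ r → HasDerivAt (fun r => Real.log (Q.eval r)) (L₁ r) r := fun r hr => by
    rw [hL₁]
    exact (Q.hasDerivAt r).log (hp r hr).ne'
  have hL₂ : ∀ r, 0 ≤ r → HasDerivAt L₁ (logDeriv₂ Q r) r := fun r hr => by
    rw [hL₁]
    exact (Q.derivative.hasDerivAt r).div (Q.hasDerivAt r) (hp r hr).ne'
  obtain ⟨f, hf⟩ : ∃ f : ℝ → ℝ, f = fun y => 4 * (L₁ (y ^ 2) + y ^ 2 * logDeriv₂ Q (y ^ 2)) :=
    ⟨_, rfl⟩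
  have hlap : (Laplacian.laplacian fun w : ℂ => Real.log (Q.eval (‖w‖ ^ 2))) = fun z => f ‖z‖ := by
    funext z
    have h := laplacian_comp_norm_sq (z := z) hL (hL₂ _ (sq_nonneg _))
    rw [hf]
    exact h
  have hG : ∀ y, HasDerivAt (fun y => 2 * (y ^ 2 * L₁ (y ^ 2))) (y * f y) y := fun y => by
    rw [hf]
    exact hasDerivAt_mul_comp_sq (hL₂ (y ^ 2) (sq_nonneg y))
  have hnn : ∀ y ∈ Set.Ioi (0 : ℝ), 0 ≤ y * f y := by
    intro y (hy : 0 < y)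
    have h3 : 0 ≤ L₁ (y ^ 2) + y ^ 2 * logDeriv₂ Q (y ^ 2) := by
      rw [hL₁]
      exact logDeriv₂_nonneg h0 hpos (pow_pos hy 2)
    rw [hf]
    exact mul_nonneg hy.le (mul_nonneg zero_le_four h3)
  -- The primitive is 2 r Q'(r)/Q(r) at r = y², and r Q'/Q tends to deg Q.
  have hlim : Filter.Tendsto (fun y : ℝ => 2 * (y ^ 2 * L₁ (y ^ 2))) Filter.atTop
      (nhds (2 * (Q.natDegree : ℝ))) := by
    have hQ : Q ≠ 0 := fun h => by simp [h] at hpos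
    have h1 := ((tendsto_eval_X_mul_derivative_div hQ).comp
      (Filter.tendsto_pow_atTop (α := ℝ) two_ne_zero)).const_mul 2
    refine h1.congr fun y => ?_
    simp only [hL₁, Function.comp, Polynomial.eval_mul, Polynomial.eval_X, mul_div_assoc]
  have hcont := (hG 0).continuousAt.continuousWithinAt (s := Set.Ici 0)
  -- A nonnegative derivative of a function with a finite limit is integrable, so the sign supplies
  -- integrability as well as the value.
  have h1 := MeasureTheory.integral_Ioi_of_hasDerivAt_of_nonneg hcont (fun y _ => hG y) hnn hlim
  have h2 := MeasureTheory.integrableOn_Ioi_deriv_of_nonneg hcont (fun y _ => hG y) hnn hlim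
  rw [hlap]
  constructor
  · rw [MeasureTheory.integrable_fun_norm_addHaar, Complex.finrank_real_complex]
    simpa only [Nat.add_one_sub_one, pow_one, smul_eq_mul] using h2
  · rw [MeasureTheory.integral_fun_norm_addHaar, Complex.finrank_real_complex]
    have h3 : MeasureTheory.volume.real (Metric.ball (0 : ℂ) 1) = Real.pi := by
      rw [MeasureTheory.measureReal_def, Complex.volume_ball]
      simp
    simp only [Nat.add_one_sub_one, pow_one, smul_eq_mul, h1, h3, nsmul_eq_mul]
    push_cast
    ring

/-- The polynomial `jmPoly` as a formal polynomial. -/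
def jmPolynomial (m : ℕ) : Polynomial ℝ :=
  ∑ i ∈ Finset.range (2 * m + 1), Polynomial.C (jmCoeff m i) * Polynomial.X ^ i

lemma eval_jmPolynomial (m : ℕ) (r : ℝ) : (jmPolynomial m).eval r = jmPoly m r := by
  simp [jmPolynomial, jmPoly, Polynomial.eval_finsetSum]

lemma coeff_jmPolynomial (m i : ℕ) :
    (jmPolynomial m).coeff i = if i < 2 * m + 1 then jmCoeff m i else 0 := by
  simp [jmPolynomial, Polynomial.coeff_X_pow]

lemma natDegree_jmPolynomial {m : ℕ} (hm : 1 ≤ m) : (jmPolynomial m).natDegree = 2 * m := by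
  refine le_antisymm ?_ (Polynomial.le_natDegree_of_ne_zero ?_)
  · refine Polynomial.natDegree_le_iff_coeff_eq_zero.mpr fun i hi => ?_
    rw [coeff_jmPolynomial, if_neg (by omega)]
  · rw [coeff_jmPolynomial, if_pos (by omega)]
    exact (one_pos.trans_le (one_le_jmCoeff hm _)).ne'

lemma integral_laplacian_log_jmPoly {m : ℕ} (hm : 1 ≤ m) :
    MeasureTheory.Integrable
        (Laplacian.laplacian fun w : ℂ => Real.log (jmPoly m (‖w‖ ^ 2))) ∧
      ∫ z : ℂ, Laplacian.laplacian (fun w : ℂ => Real.log (jmPoly m (‖w‖ ^ 2))) z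
        = 8 * m * Real.pi := by
  have h := integral_laplacian_log_eval (Q := jmPolynomial m)
    (fun i => by
      rw [coeff_jmPolynomial]
      split_ifs
      exacts [jmCoeff_nonneg m i, le_rfl])
    (by
      rw [coeff_jmPolynomial, if_pos (by omega)]
      exact one_pos.trans_le (one_le_jmCoeff hm _))
  simp only [eval_jmPolynomial] at h
  refine ⟨h.1, h.2.trans ?_⟩
  rw [natDegree_jmPolynomial hm]
  push_cast
  ring

lemma contDiff_jmPoly_norm_sq (m : ℕ) : ContDiff ℝ 2 fun w : ℂ => jmPoly m (‖w‖ ^ 2) := by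
  unfold jmPoly
  exact ContDiff.sum fun i _ => contDiff_const.mul ((contDiff_norm_sq ℝ).pow i)

lemma curvatureDensity_jmSurface {m : ℕ} (hm : 1 ≤ m) (z₀ : ℂ) {z : ℂ} (hz : z ∈ jmPlane m) :
    curvatureDensity (jmSurface m z₀) z
      = -(1 / 2) * Laplacian.laplacian (fun w : ℂ => Real.log (jmPoly m (‖w‖ ^ 2))) z := by
  have hW := isWeierstrassOn_jmSurface hm z₀
  have hE : ∀ w ∈ jmPlane m, coeffE (jmSurface m z₀ ∘ paramZero) w
      = jmPoly m (‖w‖ ^ 2) / ‖w ^ (m + 1) - 1‖ ^ 4 := fun w hw => by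
    rw [hW.coeffE_eq hw, sum_norm_jmData_sq hw]
  have hpos : 0 < coeffE (jmSurface m z₀ ∘ paramZero) z := by
    rw [hW.coeffE_eq hz]
    exact hW.sum_pos hz
  have hharm : InnerProductSpace.HarmonicAt (fun w : ℂ => Real.log ‖w ^ (m + 1) - 1‖) z :=
    AnalyticAt.harmonicAt_log_norm (by fun_prop) (sub_ne_zero.mpr hz)
  -- The logarithm of the conformal factor splits into the radial term and -4 log|P|. The latter is
  -- harmonic off the roots of unity, so only the radial term contributes curvature.
  have hev : (fun w : ℂ => Real.log (coeffE (jmSurface m z₀ ∘ paramZero) w)) =ᶠ[nhds z]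
      (fun w : ℂ => Real.log (jmPoly m (‖w‖ ^ 2)))
        - (4 : ℝ) • fun w : ℂ => Real.log ‖w ^ (m + 1) - 1‖ := by
    filter_upwards [(isOpen_jmPlane m).mem_nhds hz] with w hw
    have hP := norm_ne_zero_iff.mpr (sub_ne_zero.mpr hw)
    rw [hE w hw, Real.log_div (jmPoly_pos hm (sq_nonneg _)).ne' (pow_ne_zero _ hP), Real.log_pow]
    simp
  have hc : ContDiffAt ℝ 2 (fun w : ℂ => Real.log (jmPoly m (‖w‖ ^ 2))) z :=
    (contDiff_jmPoly_norm_sq m).contDiffAt.log (jmPoly_pos hm (sq_nonneg _)).ne'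
  rw [curvatureDensity, hW.areaDensity_eq hz, gaussCurvature,
    InnerProductSpace.laplacian_congr_nhds hev |>.self_of_nhds,
    hc.laplacian_sub (show ContDiffAt ℝ 2 ((4 : ℝ) • fun w : ℂ => Real.log ‖w ^ (m + 1) - 1‖) z from
      hharm.1.const_smul (4 : ℝ)),
    InnerProductSpace.laplacian_smul _ hharm.1, hharm.2.self_of_nhds]
  simp only [Pi.zero_apply, smul_zero, sub_zero]
  field_simp

lemma jmPlane_compl (m : ℕ) : (jmPlane m)ᶜ = jmRoots m := by
  ext z
  simp [jmPlane, mem_jmRoots]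

lemma volume_restrict_jmPlane (m : ℕ) :
    MeasureTheory.volume.restrict (jmPlane m) = MeasureTheory.volume := by
  refine MeasureTheory.Measure.restrict_eq_self_of_ae_mem ?_
  rw [MeasureTheory.ae_iff]
  exact (jmPlane_compl m ▸ (jmRoots m).finite_toSet).measure_zero _

lemma curvatureDensity_jmSurface_ae {m : ℕ} (hm : 1 ≤ m) (z₀ : ℂ) :
    curvatureDensity (jmSurface m z₀) =ᵐ[MeasureTheory.volume] fun z =>
      -(1 / 2) * Laplacian.laplacian (fun w : ℂ => Real.log (jmPoly m (‖w‖ ^ 2))) z := by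
  have h : ∀ᵐ z ∂(MeasureTheory.volume.restrict (jmPlane m)), z ∈ jmPlane m :=
    MeasureTheory.ae_restrict_mem (isOpen_jmPlane m).measurableSet
  rw [volume_restrict_jmPlane] at h
  filter_upwards [h] with z hz using curvatureDensity_jmSurface hm z₀ hz

lemma hasFiniteTotalCurvature_jmSurface {m : ℕ} (hm : 1 ≤ m) (z₀ : ℂ) :
    HasFiniteTotalCurvature (jmSurface m z₀) (jmDomain m) := by
  rw [HasFiniteTotalCurvature, IsParam.preimage_jmDomain (Or.inl rfl), MeasureTheory.IntegrableOn,
    volume_restrict_jmPlane, MeasureTheory.integrable_congr (curvatureDensity_jmSurface_ae hm z₀)]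
  exact (integral_laplacian_log_jmPoly hm).1.const_mul _

lemma totalCurvature_jmSurface {m : ℕ} (hm : 1 ≤ m) (z₀ : ℂ) :
    totalCurvature (jmSurface m z₀) (jmDomain m) = -4 * m * Real.pi := by
  rw [totalCurvature, IsParam.preimage_jmDomain (Or.inl rfl), volume_restrict_jmPlane,
    MeasureTheory.integral_congr_ae (curvatureDensity_jmSurface_ae hm z₀),
    MeasureTheory.integral_const_mul, (integral_laplacian_log_jmPoly hm).2]
  ring

/-! ### Completeness -/

/-- A function u with |du| ≤ C |df| is C-Lipschitz for the induced distance. The inequality is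
integrated along the curve, each time being treated in a chart. -/
lemma enorm_sub_le_mul_inducedLength {n : ℕ} {f : RSphere → EuclideanSpace ℝ (Fin n)}
    {M : Set RSphere} (hf : IsConformalMinimalImmersion f M) {u : RSphere → ℂ} {C : NNReal}
    (hu : ∀ σ, IsParam σ → ContDiffOn ℝ 1 (u ∘ σ) (σ ⁻¹' M))
    (hC : ∀ σ, IsParam σ → ∀ z ∈ σ ⁻¹' M, ∀ v,
      ‖fderiv ℝ (u ∘ σ) z v‖ ≤ C * ‖fderiv ℝ (f ∘ σ) z v‖)
    {γ : ℝ → RSphere} (hγ : IsC1CurveIn M γ) :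
    ‖u (γ 1) - u (γ 0)‖ₑ ≤ C * inducedLength f γ := by
  have hcd : ContDiffOn ℝ 1 (u ∘ γ) (Set.Icc 0 1) := by
    intro t ht
    obtain ⟨hM, σ, η, hσ, hη, hev⟩ := hγ t ht
    have ht' : γ t = σ (η t) := hev.eq_of_nhdsWithin ht
    have hηt : η t ∈ σ ⁻¹' M := by rwa [Set.mem_preimage, ← ht']
    have h1 : ContDiffWithinAt ℝ 1 ((u ∘ σ) ∘ η) (Set.Icc 0 1) t :=
      ((hu σ hσ).contDiffAt ((hf σ hσ).isOpen.mem_nhds hηt)).comp_contDiffWithinAt t hη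
    refine h1.congr_of_eventuallyEq ?_ (congrArg u ht')
    filter_upwards [hev] with s hs using congrArg u hs
  refine (enorm_sub_le_lintegral_deriv_of_contDiffOn_Icc hcd zero_le_one).trans ?_
  rw [inducedLength, ← MeasureTheory.lintegral_const_mul' _ _ ENNReal.coe_ne_top]
  refine MeasureTheory.lintegral_mono_ae ?_
  -- The endpoints are null; at interior times derivatives within the interval are genuine
  -- derivatives.
  rw [← MeasureTheory.restrict_Ioo_eq_restrict_Icc]
  filter_upwards [MeasureTheory.self_mem_ae_restrict measurableSet_Ioo] with t ht
  have hn := Icc_mem_nhds ht.1 ht.2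
  have htI : t ∈ Set.Icc (0 : ℝ) 1 := ⟨ht.1.le, ht.2.le⟩
  obtain ⟨hM, σ, η, hσ, hη, hev⟩ := hγ t htI
  have ht' : γ t = σ (η t) := hev.eq_of_nhdsWithin htI
  have hηt : η t ∈ σ ⁻¹' M := by rwa [Set.mem_preimage, ← ht']
  rw [nhdsWithin_eq_nhds.mpr hn] at hev
  have hd := ((hη.contDiffAt hn).differentiableAt one_ne_zero).hasDerivAt
  have hopen := (hf σ hσ).isOpen.mem_nhds hηt
  have h1 : HasDerivAt ((u ∘ σ) ∘ η) _ t := (((hu σ hσ).contDiffAt hopen).differentiableAt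
    one_ne_zero).hasFDerivAt.comp_hasDerivAt t hd
  have h2 : HasDerivAt ((f ∘ σ) ∘ η) _ t := (((hf σ hσ).smooth.contDiffAt hopen).differentiableAt
    (by simp)).hasFDerivAt.comp_hasDerivAt t hd
  have e1 : deriv (u ∘ γ) t = fderiv ℝ (u ∘ σ) (η t) (deriv η t) := by
    rw [← h1.deriv]
    exact Filter.EventuallyEq.deriv_eq (hev.mono fun s hs => congrArg u hs)
  have e2 : deriv (f ∘ γ) t = fderiv ℝ (f ∘ σ) (η t) (deriv η t) := by
    rw [← h2.deriv]
    exact Filter.EventuallyEq.deriv_eq (hev.mono fun s hs => congrArg f hs)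
  rw [e1, e2, ← ofReal_norm, ← ofReal_norm, ← ENNReal.ofReal_coe_nnreal,
    ← ENNReal.ofReal_mul C.coe_nonneg]
  exact ENNReal.ofReal_le_ofReal (hC σ hσ _ hηt _)

lemma enorm_sub_div_le_inducedEDist {n : ℕ} {f : RSphere → EuclideanSpace ℝ (Fin n)}
    {M : Set RSphere} (hf : IsConformalMinimalImmersion f M) {u : RSphere → ℂ} {C : NNReal}
    (hu : ∀ σ, IsParam σ → ContDiffOn ℝ 1 (u ∘ σ) (σ ⁻¹' M))
    (hC : ∀ σ, IsParam σ → ∀ z ∈ σ ⁻¹' M, ∀ v,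
      ‖fderiv ℝ (u ∘ σ) z v‖ ≤ C * ‖fderiv ℝ (f ∘ σ) z v‖) (p q : RSphere) :
    ‖u p - u q‖ₑ / C ≤ inducedEDist f M p q := by
  refine le_iInf₂ fun γ hγ => ENNReal.div_le_of_le_mul' ?_
  have h := enorm_sub_le_mul_inducedLength hf hu hC hγ.1
  rw [hγ.2.1, hγ.2.2] at h
  rwa [← enorm_neg, neg_sub]

lemma cauchySeq_comp_of_inducedEDist {n : ℕ} {f : RSphere → EuclideanSpace ℝ (Fin n)}
    {M : Set RSphere} (hf : IsConformalMinimalImmersion f M) {u : RSphere → ℂ} {C : NNReal}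
    (hC0 : C ≠ 0) (hu : ∀ σ, IsParam σ → ContDiffOn ℝ 1 (u ∘ σ) (σ ⁻¹' M))
    (hC : ∀ σ, IsParam σ → ∀ z ∈ σ ⁻¹' M, ∀ v,
      ‖fderiv ℝ (u ∘ σ) z v‖ ≤ C * ‖fderiv ℝ (f ∘ σ) z v‖) {x : ℕ → RSphere}
    (hx : ∀ ε : ENNReal, 0 < ε → ∃ N, ∀ i j, N ≤ i → N ≤ j → inducedEDist f M (x i) (x j) < ε) :
    CauchySeq fun i => u (x i) := by
  refine EMetric.cauchySeq_iff.mpr fun ε hε => ?_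
  obtain ⟨N, hN⟩ := hx (ε / C) (ENNReal.div_pos hε.ne' ENNReal.coe_ne_top)
  refine ⟨N, fun i hi j hj => ?_⟩
  rw [edist_eq_enorm_sub]
  have h := (enorm_sub_div_le_inducedEDist hf hu hC (x i) (x j)).trans_lt (hN i j hi hj)
  exact (ENNReal.div_lt_div_iff_left (by exact_mod_cast hC0) ENNReal.coe_ne_top).mp h

lemma inducedEDist_le_of_segment {n : ℕ} {f : RSphere → EuclideanSpace ℝ (Fin n)}
    {M : Set RSphere} (hf : IsConformalMinimalImmersion f M) {σ : ℂ → RSphere} (hσ : IsParam σ)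
    {a b : ℂ} {K : ℝ} (hM : segment ℝ a b ⊆ σ ⁻¹' M)
    (hK : ∀ z ∈ segment ℝ a b, ‖fderiv ℝ (f ∘ σ) z‖ ≤ K) :
    inducedEDist f M (σ a) (σ b) ≤ ENNReal.ofReal (K * ‖b - a‖) := by
  have hmem : ∀ t ∈ Set.Icc (0 : ℝ) 1, AffineMap.lineMap a b t ∈ segment ℝ a b := fun t ht => by
    rw [segment_eq_image_lineMap]
    exact ⟨t, ht, rfl⟩
  have hcd : ContDiff ℝ 1 (AffineMap.lineMap a b : ℝ → ℂ) :=
    AffineMap.contDiff_lineMap a b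
  refine (iInf₂_le (σ ∘ AffineMap.lineMap a b) ⟨fun t ht => ⟨hM (hmem t ht), σ,
    AffineMap.lineMap a b, hσ, hcd.contDiffWithinAt, Filter.EventuallyEq.rfl⟩,
    by simp, by simp⟩).trans ?_
  · have h : ∀ t ∈ Set.Icc (0 : ℝ) 1, ‖deriv (f ∘ σ ∘ AffineMap.lineMap a b) t‖ₑ
        ≤ ENNReal.ofReal (K * ‖b - a‖) := by
      intro t ht
      have hz := hmem t ht
      have h1 : HasDerivAt ((f ∘ σ) ∘ AffineMap.lineMap a b) _ t :=
        (((hf σ hσ).smooth.contDiffAt ((hf σ hσ).isOpen.mem_nhds (hM hz))).differentiableAt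
          (by simp)).hasFDerivAt.comp_hasDerivAt t AffineMap.hasDerivAt_lineMap
      have h2 := h1.deriv
      rw [Function.comp_assoc] at h2
      rw [h2, ← ofReal_norm]
      refine ENNReal.ofReal_le_ofReal ((ContinuousLinearMap.le_opNorm _ _).trans ?_)
      exact mul_le_mul_of_nonneg_right (hK _ hz) (norm_nonneg _)
    refine (MeasureTheory.setLIntegral_mono measurable_const h).trans ?_
    simp

/-- Near a the differential is bounded, so straight segments in the chart bound the induced distance
by a multiple of the Euclidean one. -/
lemma tendsto_inducedEDist {n : ℕ} {f : RSphere → EuclideanSpace ℝ (Fin n)}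
    {M : Set RSphere} (hf : IsConformalMinimalImmersion f M) {σ : ℂ → RSphere} (hσ : IsParam σ)
    {a : ℂ} (ha : σ a ∈ M) {z : ℕ → ℂ} (hz : Filter.Tendsto z Filter.atTop (nhds a)) :
    Filter.Tendsto (fun i => inducedEDist f M (σ (z i)) (σ a)) Filter.atTop (nhds 0) := by
  have hopen := (hf σ hσ).isOpen.mem_nhds (show a ∈ σ ⁻¹' M from ha)
  have hcont : ContinuousAt (fun w => ‖fderiv ℝ (f ∘ σ) w‖) a :=
    (((hf σ hσ).smooth.contDiffAt hopen).fderiv_right (m := 0) (by simp)).continuousAt.norm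
  have hev := hcont.eventually (gt_mem_nhds (lt_add_one ‖fderiv ℝ (f ∘ σ) a‖))
  obtain ⟨ε, hε, hball⟩ := Metric.mem_nhds_iff.mp (Filter.inter_mem hopen hev)
  have hle : ∀ᶠ i in Filter.atTop, inducedEDist f M (σ (z i)) (σ a)
      ≤ ENNReal.ofReal ((‖fderiv ℝ (f ∘ σ) a‖ + 1) * ‖a - z i‖) := by
    filter_upwards [hz.eventually (Metric.ball_mem_nhds a hε)] with i hi
    have hseg : segment ℝ (z i) a ⊆ Metric.ball a ε :=
      (convex_ball a ε).segment_subset hi (Metric.mem_ball_self hε)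
    exact inducedEDist_le_of_segment hf hσ (fun w hw => (hball (hseg hw)).1)
      fun w hw => (hball (hseg hw)).2.le
  refine tendsto_of_tendsto_of_tendsto_of_le_of_le' tendsto_const_nhds ?_
    (Filter.Eventually.of_forall fun _ => zero_le) hle
  have h1 : Filter.Tendsto (fun i => (‖fderiv ℝ (f ∘ σ) a‖ + 1) * ‖a - z i‖) Filter.atTop
      (nhds ((‖fderiv ℝ (f ∘ σ) a‖ + 1) * ‖a - a‖)) :=
    (tendsto_const_nhds.sub hz).norm.const_mul _
  simpa using ENNReal.tendsto_ofReal h1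

/-- The meromorphic function `z ^ q / (z ^ (m + 1) - 1)` on the sphere, for `q ≤ m`. -/
def jmQuot (m q : ℕ) (p : RSphere) : ℂ := OnePoint.elim p 0 fun z => z ^ q / (z ^ (m + 1) - 1)

lemma jmQuot_paramInfty {m q : ℕ} (hq : q ≤ m) {w : ℂ} (hw : w ^ (m + 1) ≠ 1) :
    jmQuot m q (paramInfty w) = -(w ^ (m + 1 - q) / (w ^ (m + 1) - 1)) := by
  by_cases h0 : w = 0
  · rw [paramInfty, if_pos h0, h0, zero_pow (by omega), zero_div, neg_zero]
    rfl
  · rw [paramInfty, if_neg h0]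
    exact inv_pow_div h0 hw (by omega)

/-- At ∞ the exponent q becomes m + 1 - q, so a derivative estimate for all exponents up to m + 1
serves both charts. -/
lemma jmQuot_param {m q : ℕ} (hq : q ≤ m) {σ : ℂ → RSphere} (hσ : IsParam σ) :
    ∃ (c : ℂ) (q' : ℕ), ‖c‖ = 1 ∧ q' ≤ m + 1 ∧
      ∀ z ∈ jmPlane m, jmQuot m q (σ z) = c * (z ^ q' / (z ^ (m + 1) - 1)) := by
  rcases hσ with rfl | rfl
  · exact ⟨1, q, norm_one, by omega, fun z _ => (one_mul _).symm⟩
  · exact ⟨-1, m + 1 - q, by simp, by omega, fun z hz => by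
      rw [jmQuot_paramInfty hq hz, neg_one_mul]⟩

lemma pow_norm_le_sqrt_jmPoly {m : ℕ} (hm : 1 ≤ m) (z : ℂ) {i : ℕ} (hi : i ≤ 2 * m) :
    ‖z‖ ^ i ≤ Real.sqrt (jmPoly m (‖z‖ ^ 2)) := by
  refine Real.le_sqrt_of_sq_le ?_
  rw [← pow_mul, mul_comm, pow_mul]
  exact pow_le_jmPoly hm (sq_nonneg _) hi

/-- With d = m + 1 - q the numerator of the derivative is -(d z^(q+m) + q z^(q-1)). Both monomials
are bounded by the square root of `jmPoly`, and the coefficients add up to m + 1, which is the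
Lipschitz constant. -/
lemma norm_deriv_quot_le {m q : ℕ} (hm : 1 ≤ m) (hq : q ≤ m + 1) (z : ℂ) :
    ‖q * z ^ (q - 1) * (z ^ (m + 1) - 1) - z ^ q * ((m + 1) * z ^ m)‖
      ≤ (m + 1) * Real.sqrt (jmPoly m (‖z‖ ^ 2)) := by
  obtain ⟨d, hd⟩ := Nat.exists_eq_add_of_le hq
  have h1 : (q : ℂ) * z ^ (q - 1) * (z ^ (m + 1) - 1) - z ^ q * ((m + 1) * z ^ m)
      = -(d * z ^ (q + m)) - q * z ^ (q - 1) := by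
    have hdc : (m : ℂ) + 1 = q + d := by exact_mod_cast hd
    rw [hdc]
    rcases q with _ | q
    · simp
    · rw [Nat.add_sub_cancel]
      push_cast
      ring
  have h2 : (d : ℝ) * ‖z‖ ^ (q + m) ≤ d * Real.sqrt (jmPoly m (‖z‖ ^ 2)) := by
    -- For d = 0 the exponent q + m = 2m + 1 is too large for the bound, but the coefficient
    -- vanishes.
    rcases d.eq_zero_or_pos with rfl | h
    · simp
    · exact mul_le_mul_of_nonneg_left (pow_norm_le_sqrt_jmPoly hm z (by omega)) d.cast_nonneg
  have h3 : (q : ℝ) * ‖z‖ ^ (q - 1) ≤ q * Real.sqrt (jmPoly m (‖z‖ ^ 2)) :=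
    mul_le_mul_of_nonneg_left (pow_norm_le_sqrt_jmPoly hm z (by omega)) q.cast_nonneg
  have hdr : (m : ℝ) + 1 = q + d := by exact_mod_cast hd
  rw [h1, hdr]
  refine (norm_sub_le _ _).trans ?_
  rw [norm_neg, norm_mul, norm_mul, norm_pow, norm_pow, Complex.norm_natCast, Complex.norm_natCast]
  linarith

lemma contDiffOn_jmQuot {m q : ℕ} (hq : q ≤ m) (σ : ℂ → RSphere) (hσ : IsParam σ) :
    ContDiffOn ℝ 1 (jmQuot m q ∘ σ) (σ ⁻¹' jmDomain m) := by
  obtain ⟨c, q', -, -, h⟩ := jmQuot_param hq hσ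
  rw [hσ.preimage_jmDomain]
  have hd : DifferentiableOn ℂ (fun z : ℂ => c * (z ^ q' / (z ^ (m + 1) - 1))) (jmPlane m) :=
    fun z hz => ((hasDerivAt_pow_div q' hz).const_mul c).differentiableAt.differentiableWithinAt
  exact ((hd.contDiffOn (isOpen_jmPlane m)).restrict_scalars ℝ).congr h

lemma norm_fderiv_jmQuot_le {m q : ℕ} (hm : 1 ≤ m) (hq : q ≤ m) (z₀ : ℂ) (σ : ℂ → RSphere)
    (hσ : IsParam σ) (z : ℂ) (hz : z ∈ σ ⁻¹' jmDomain m) (v : ℂ) :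
    ‖fderiv ℝ (jmQuot m q ∘ σ) z v‖
      ≤ (m + 1 : NNReal) * ‖fderiv ℝ (jmSurface m z₀ ∘ σ) z v‖ := by
  obtain ⟨c, q', hc, hq', h⟩ := jmQuot_param hq hσ
  rw [hσ.preimage_jmDomain] at hz
  have hd := ((hasDerivAt_pow_div q' hz).const_mul c).hasFDerivAt.restrictScalars ℝ
  have hev : jmQuot m q ∘ σ =ᶠ[nhds z] fun z : ℂ => c * (z ^ q' / (z ^ (m + 1) - 1)) := by
    filter_upwards [(isOpen_jmPlane m).mem_nhds hz] with w hw using h w hw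
  rw [hev.fderiv_eq, hd.fderiv, norm_fderiv_jmSurface hm z₀ hσ hz]
  have h1 := norm_deriv_quot_le hm hq' z
  have hP := norm_pos_iff.mpr (sub_ne_zero.mpr (show z ^ (m + 1) ≠ 1 from hz))
  simp only [ContinuousLinearMap.coe_restrictScalars', ContinuousLinearMap.toSpanSingleton_apply,
    smul_eq_mul, norm_mul, norm_div, norm_pow, hc, one_mul]
  rw [mul_left_comm ((m + 1 : NNReal) : ℝ)]
  refine mul_le_mul_of_nonneg_left ?_ (norm_nonneg v)
  rw [← mul_div_assoc]
  refine div_le_div_of_nonneg_right ?_ (by positivity)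
  simpa using h1

lemma cauchySeq_jmQuot {m q : ℕ} (hm : 1 ≤ m) (hq : q ≤ m) (z₀ : ℂ) {x : ℕ → RSphere}
    (hx : ∀ ε : ENNReal, 0 < ε → ∃ N, ∀ i j, N ≤ i → N ≤ j →
      inducedEDist (jmSurface m z₀) (jmDomain m) (x i) (x j) < ε) :
    CauchySeq fun i => jmQuot m q (x i) :=
  cauchySeq_comp_of_inducedEDist (C := m + 1) (isConformalMinimalImmersion_jmSurface hm z₀)
    (by positivity) (contDiffOn_jmQuot hq) (norm_fderiv_jmQuot_le hm hq z₀) hx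

/-- The coordinate `1 / z` on the sphere, with the junk value `0` at `z = 0`. -/
def coordInfty (p : RSphere) : ℂ := OnePoint.elim p 0 fun z => z⁻¹

/-- The identity also holds at z = 0, where the denominator 1 + u_0 vanishes and both sides take the
default value 0. -/
lemma coordInfty_pow {m : ℕ} {p : RSphere} (hp : p ∈ jmDomain m) :
    coordInfty p ^ (m + 1) = jmQuot m 0 p / (1 + jmQuot m 0 p) := by
  induction p using OnePoint.rec with
  | infty => simp [coordInfty, jmQuot]
  | coe z =>
    have hP : z ^ (m + 1) - 1 ≠ 0 := sub_ne_zero.mpr (paramZero_mem_jmDomain.mp hp)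
    change z⁻¹ ^ (m + 1) = (z ^ 0 / (z ^ (m + 1) - 1)) / (1 + z ^ 0 / (z ^ (m + 1) - 1))
    have h1 : 1 + z ^ 0 / (z ^ (m + 1) - 1) = z ^ (m + 1) / (z ^ (m + 1) - 1) := by
      field_simp
      ring
    rw [h1, pow_zero, div_div_div_cancel_right₀ hP, inv_pow, one_div]

lemma paramInfty_coordInfty {m : ℕ} {p : RSphere} (hp : jmQuot m 0 p ≠ -1) :
    paramInfty (coordInfty p) = p := by
  induction p using OnePoint.rec with
  | infty => exact if_pos rfl
  | coe z =>
    have hz : z ≠ 0 := by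
      rintro rfl
      refine hp ?_
      change (0 : ℂ) ^ 0 / (0 ^ (m + 1) - 1) = -1
      simp
    change paramInfty z⁻¹ = _
    rw [paramInfty, if_neg (inv_ne_zero hz), inv_inv]

/-- The second identity passes to limits, where it shows that the limit of u_1/u_0 is not a root of
unity. -/
lemma eq_paramZero_of_jmQuot_ne_zero {m : ℕ} {p : RSphere} (hp : jmQuot m 0 p ≠ 0) :
    paramZero (jmQuot m 1 p / jmQuot m 0 p) = p
      ∧ jmQuot m 0 p * ((jmQuot m 1 p / jmQuot m 0 p) ^ (m + 1) - 1) = 1 := by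
  induction p using OnePoint.rec with
  | infty => exact (hp rfl).elim
  | coe z =>
    have h0 : jmQuot m 0 (z : OnePoint ℂ) = 1 / (z ^ (m + 1) - 1) := by
      change z ^ 0 / _ = _
      rw [pow_zero]
    have h1 : jmQuot m 1 (z : OnePoint ℂ) = z / (z ^ (m + 1) - 1) := by
      change z ^ 1 / _ = _
      rw [pow_one]
    have hP : z ^ (m + 1) - 1 ≠ 0 := by
      intro h
      rw [h0, h, div_zero] at hp
      exact hp rfl
    have h2 : jmQuot m 1 (z : OnePoint ℂ) / jmQuot m 0 (z : OnePoint ℂ) = z := by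
      rw [h0, h1]
      field_simp
    rw [h2, h0]
    exact ⟨rfl, one_div_mul_cancel hP⟩

lemma isCompleteImmersion_jmSurface {m : ℕ} (hm : 1 ≤ m) (z₀ : ℂ) :
    IsCompleteImmersion (jmSurface m z₀) (jmDomain m) := by
  intro x hxM hx
  have hf := isConformalMinimalImmersion_jmSurface hm z₀
  obtain ⟨a, ha⟩ := cauchySeq_tendsto_of_complete (cauchySeq_jmQuot hm (Nat.zero_le m) z₀ hx)
  -- The exponent is q = 1 here, admissible since 1 ≤ m.
  obtain ⟨b, hb⟩ := cauchySeq_tendsto_of_complete (cauchySeq_jmQuot hm hm z₀ hx)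
  -- If u_0 → 0 then 1/z → 0 and the sequence tends to ∞, a point of the surface; otherwise z =
  -- u_1/u_0 tends to b/a.
  by_cases h0 : a = 0
  · subst h0
    have hpow : Filter.Tendsto (fun i => coordInfty (x i) ^ (m + 1)) Filter.atTop (nhds 0) := by
      have h1 := ha.div (ha.const_add 1) (by simp)
      rw [zero_div] at h1
      exact h1.congr fun i => (coordInfty_pow (hxM i)).symm
    have hw : Filter.Tendsto (fun i => coordInfty (x i)) Filter.atTop (nhds 0) := by
      rw [Metric.tendsto_atTop] at hpow ⊢
      intro ε hε
      obtain ⟨N, hN⟩ := hpow (ε ^ (m + 1)) (by positivity)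
      refine ⟨N, fun i hi => ?_⟩
      have h1 := hN i hi
      rw [dist_zero_right, norm_pow] at h1
      rw [dist_zero_right]
      exact lt_of_pow_lt_pow_left₀ _ hε.le h1
    have hp : paramInfty 0 ∈ jmDomain m := paramInfty_mem_jmDomain.mpr (by simp)
    refine ⟨paramInfty 0, hp, (tendsto_inducedEDist hf (Or.inr rfl) hp hw).congr' ?_⟩
    filter_upwards [ha.eventually_ne (show (0 : ℂ) ≠ -1 by norm_num)] with i hi
    rw [paramInfty_coordInfty hi]
  · have hz := hb.div ha h0
    have hev := ha.eventually_ne h0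
    have hlim : a * ((b / a) ^ (m + 1) - 1) = 1 := by
      refine tendsto_nhds_unique (ha.mul ((hz.pow (m + 1)).sub_const 1)) ?_
      refine tendsto_const_nhds.congr' ?_
      filter_upwards [hev] with i hi using (eq_paramZero_of_jmQuot_ne_zero hi).2.symm
    have hp : paramZero (b / a) ∈ jmDomain m := paramZero_mem_jmDomain.mpr fun h => by
      rw [h, sub_self, mul_zero] at hlim
      exact zero_ne_one hlim
    refine ⟨paramZero (b / a), hp, (tendsto_inducedEDist hf (Or.inl rfl) hp hz).congr' ?_⟩
    filter_upwards [hev] with i hi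
    exact congrArg (fun p => inducedEDist _ _ p _) (eq_paramZero_of_jmQuot_ne_zero hi).1

/-! ### Independence of the Weierstrass data, ends and path integrals -/

lemma eq_zero_of_sum_mul_jmData {m : ℕ} (hm : 1 ≤ m) {b : ℕ → ℂ}
    (h : ∀ z ∈ jmPlane m, ∑ k : Fin (2 * m + 1), b k * jmData m z k = 0) (k : Fin (2 * m + 1)) :
    b k = 0 := by
  -- These are the coefficients of P² Σ b_k φ_k. The numerators z^j - z^(2m-j) and i(z^j + z^(2m-j))
  -- reach only the degrees j and 2m - j, and the middle degree belongs to the last entry.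
  let c : ℕ → ℂ := fun i => if i < m then b (2 * i) + Complex.I * b (2 * i + 1)
    else if i = m then 2 * (Real.sqrt m : ℂ) * b (2 * m)
    else -b (2 * (2 * m - i)) + Complex.I * b (2 * (2 * m - i) + 1)
  let R : Polynomial ℂ := ∑ i ∈ Finset.range (2 * m + 1), Polynomial.C (c i) * Polynomial.X ^ i
  have hroot : ∀ z ∈ jmPlane m, R.IsRoot z := by
    intro z hz
    have hP : z ^ (m + 1) - 1 ≠ 0 := sub_ne_zero.mpr hz
    have h1 := h z hz
    rw [sum_jmData m z fun k x => b k * x] at h1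
    have h2 : R.eval z = (z ^ (m + 1) - 1) ^ 2 * 0 := by
      rw [← h1, mul_add, Finset.mul_sum]
      simp only [R, Polynomial.eval_finsetSum, Polynomial.eval_mul, Polynomial.eval_C,
        Polynomial.eval_pow, Polynomial.eval_X]
      rw [sum_range_two_mul_add_one]
      congr 1
      · refine Finset.sum_congr rfl fun j hj => ?_
        have hjm := Finset.mem_range.mp hj
        have e1 : c j = b (2 * j) + Complex.I * b (2 * j + 1) := if_pos hjm
        have e2 : c (2 * m - j) = -b (2 * j) + Complex.I * b (2 * j + 1) := by
          simp only [c]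
          rw [if_neg (by omega), if_neg (by omega), show 2 * m - (2 * m - j) = j by omega]
        rw [e1, e2, jmG, jmH, show 2 * m - j = j + (2 * m - 2 * j) by omega, pow_add]
        field_simp
        ring
      · have e1 : c m = 2 * (Real.sqrt m : ℂ) * b (2 * m) := by simp [c]
        rw [e1]
        field_simp
    rw [Polynomial.IsRoot, h2, mul_zero]
  have hinf : (jmPlane m).Infinite := by
    rw [← compl_compl (jmPlane m), jmPlane_compl]
    exact (jmRoots m).finite_toSet.infinite_compl
  have hR : R = 0 := Polynomial.eq_zero_of_infinite_isRoot R (hinf.mono hroot)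
  have hc : ∀ i < 2 * m + 1, c i = 0 := by
    intro i hi
    have h1 : R.coeff i = c i := by
      simp only [R, Polynomial.finsetSum_coeff, Polynomial.coeff_C_mul, Polynomial.coeff_X_pow,
        mul_ite, mul_one, mul_zero, Finset.sum_ite_eq, Finset.mem_range, if_pos hi]
    rw [← h1, hR, Polynomial.coeff_zero]
  have hpair : ∀ j < m, b (2 * j) = 0 ∧ b (2 * j + 1) = 0 := by
    intro j hj
    have e1 := hc j (by omega)
    have e2 := hc (2 * m - j) (by omega)
    simp only [c] at e1 e2
    rw [if_pos hj] at e1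
    rw [if_neg (by omega), if_neg (by omega), show 2 * m - (2 * m - j) = j by omega] at e2
    have h1 : b (2 * j) = 0 := by linear_combination (e1 - e2) / 2
    rw [h1, zero_add] at e1
    exact ⟨h1, (mul_eq_zero.mp e1).resolve_left Complex.I_ne_zero⟩
  refine jmCases_induction (p := fun k => b k = 0) (fun j hj => (hpair j hj).1)
    (fun j hj => (hpair j hj).2) ?_ k
  have e1 := hc m (by omega)
  simp only [c, lt_irrefl, if_false, if_true] at e1
  refine (mul_eq_zero.mp e1).resolve_left (mul_ne_zero two_ne_zero ?_)
  rw [Complex.ofReal_ne_zero, Real.sqrt_ne_zero']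
  exact_mod_cast hm

lemma eq_zero_of_sum_mul_jmData' {m : ℕ} (hm : 1 ≤ m) {b : Fin (2 * m + 1) → ℂ}
    (h : ∀ z ∈ jmPlane m, ∑ k, b k * jmData m z k = 0) : b = 0 := by
  have hb : ∀ k : Fin (2 * m + 1), Function.extend Fin.val b 0 (k : ℕ) = b k :=
    Fin.val_injective.extend_apply b 0
  funext k
  rw [← hb k]
  exact eq_zero_of_sum_mul_jmData hm (fun z hz => by simp only [hb, h z hz]) k

lemma isFull_jmSurface {m : ℕ} (hm : 1 ≤ m) (z₀ : ℂ) : IsFull (jmSurface m z₀) (jmDomain m) := by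
  intro a c ha h
  refine ha ?_
  have hW := isWeierstrassOn_jmSurface hm z₀
  let L : EuclideanSpace ℝ (Fin (2 * m + 1)) →L[ℝ] ℝ := innerSL ℝ a
  have h0 : (fun k => (a k : ℂ)) = 0 := by
    refine eq_zero_of_sum_mul_jmData' hm fun z hz => ?_
    have h1 : HasFDerivAt (L ∘ (jmSurface m z₀ ∘ paramZero)) (L ∘L weierstrassDeriv (jmData m z)) z :=
      L.hasFDerivAt.comp z (hW.hasFDerivAt z hz)
    have h2 : HasFDerivAt (L ∘ (jmSurface m z₀ ∘ paramZero)) (0 : ℂ →L[ℝ] ℝ) z := by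
      refine (hasFDerivAt_const c z).congr_of_eventuallyEq ?_
      filter_upwards [(isOpen_jmPlane m).mem_nhds hz] with w hw using
        h _ (paramZero_mem_jmDomain.mpr hw)
    have h3 := h1.unique h2
    -- If ⟨a, f⟩ is constant, its differential v ↦ Re(v Σ a_k φ_k) vanishes. Taking v = 1 and v = i
    -- kills the real and imaginary parts of the sum.
    have h4 : ∀ v, (v * ∑ k, (a k : ℂ) * jmData m z k).re = 0 := by
      intro v
      have h5 : inner ℝ a (weierstrassDeriv (jmData m z) v) = 0 := DFunLike.congr_fun h3 v
      rw [← h5, PiLp.inner_apply, Finset.mul_sum, Complex.re_sum]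
      refine Finset.sum_congr rfl fun k _ => ?_
      simp only [weierstrassDeriv_apply, RCLike.inner_apply, conj_trivial]
      rw [mul_left_comm, Complex.re_ofReal_mul, mul_comm]
    refine Complex.ext ?_ ?_
    · simpa using h4 1
    · simpa using h4 Complex.I
  ext k
  exact Complex.ofReal_eq_zero.mp (congrFun h0 k)

lemma hasNondegenerateGaussMap_jmSurface {m : ℕ} (hm : 1 ≤ m) (z₀ : ℂ) :
    HasNondegenerateGaussMap (jmSurface m z₀) (jmDomain m) := by
  intro W hW
  by_contra hne
  -- A proper subspace lies in the kernel of a nonzero functional, whose coefficients would give a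
  -- linear relation among the entries of φ.
  obtain ⟨ℓ, hℓ, hker⟩ := W.exists_le_ker_of_lt_top (lt_top_iff_ne_top.mpr hne)
  have hWs := isWeierstrassOn_jmSurface hm z₀
  have hmem : ∀ z ∈ jmPlane m, jmData m z ∈ W := by
    intro z hz
    have hcp := hWs.complexPartial_eq hz
    have h0 : complexPartial (jmSurface m z₀ ∘ paramZero) z ≠ 0 := by
      rw [hcp]
      exact smul_ne_zero (by norm_num) (hWs.ne_zero z hz)
    have h1 := hW _ ⟨paramZero, z, Or.inl rfl, paramZero_mem_jmDomain.mpr hz, h0, rfl⟩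
    rw [Projectivization.submodule_mk, Submodule.span_singleton_le_iff_mem, hcp] at h1
    exact (W.smul_mem_iff (by norm_num)).mp h1
  have hb : (fun k => ℓ (Pi.single k 1)) = 0 := by
    refine eq_zero_of_sum_mul_jmData' hm fun z hz => ?_
    have h1 : ℓ (jmData m z) = 0 := hker (hmem z hz)
    rw [← h1, LinearMap.pi_apply_eq_sum_univ ℓ (jmData m z)]
    refine Finset.sum_congr rfl fun k _ => ?_
    rw [smul_eq_mul, mul_comm]
    congr 2
    funext i
    simp [Pi.single_apply, eq_comm]
  refine hℓ (LinearMap.pi_ext' fun k => LinearMap.ext_ring ?_)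
  exact congrFun hb k

/-! ### Number of ends and Euler number -/

lemma compl_jmDomain (m : ℕ) : (jmDomain m)ᶜ = paramZero '' (jmRoots m : Set ℂ) := by
  rw [jmDomain, compl_compl]
  congr 1
  ext z
  exact mem_jmRoots.symm

lemma numEnds_jmDomain (m : ℕ) : numEnds (jmDomain m) = m + 1 := by
  rw [numEnds, compl_jmDomain, Set.ncard_image_of_injective (f := paramZero) _ OnePoint.coe_injective,
    Set.ncard_coe_finset, card_jmRoots]

lemma hasEulerNumber_jmDomain (m : ℕ) : HasEulerNumber (jmDomain m) (1 - m) := by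
  refine ⟨?_, 2, hasCellularEulerNumber_sphere, ?_⟩
  · rw [compl_jmDomain]
    exact (jmRoots m).finite_toSet.image _
  · rw [numEnds_jmDomain]
    push_cast
    ring

/-- Along a C¹ path the real part of the integrand is the derivative of the primitive composed with
the path, so the fundamental theorem of calculus leaves only the endpoint values. -/
lemma isJorgeMeeksIntegral_jmSurface (m : ℕ) (z₀ : ℂ) :
    IsJorgeMeeksIntegral m z₀ (jmSurface m z₀) := by
  intro z γ hγ hγM k
  have hmem : ∀ t, γ.extend t ∈ jmPlane m := fun t =>
    paramZero_mem_jmDomain.mp (hγM (Set.projIcc 0 1 zero_le_one t))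
  have hfun : ∀ t, curveIntegralFun
      (fun w => ContinuousLinearMap.toSpanSingleton ℂ (jmData m w k)) γ t
      = derivWithin γ.extend (Set.Icc 0 1) t * jmData m (γ.extend t) k := fun t => by
    rw [curveIntegralFun_def]
    simp
  have hcont : ContinuousOn
      (fun t => derivWithin γ.extend (Set.Icc 0 1) t * jmData m (γ.extend t) k)
      (Set.Icc 0 1) := by
    refine (hγ.continuousOn_derivWithin (uniqueDiffOn_Icc_zero_one) le_rfl).mul ?_
    exact (differentiableOn_jmData m k).continuousOn.comp γ.continuous_extend.continuousOn
      fun t _ => hmem t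
  have hint := (hcont.intervalIntegrable_of_Icc zero_le_one (μ := MeasureTheory.volume))
  rw [jmSurface_paramZero, curveIntegral_def]
  simp only [hfun]
  have hre := Complex.reCLM.intervalIntegral_comp_comm hint
  rw [Complex.reCLM_apply] at hre
  rw [← hre]
  have hg := intervalIntegral.integral_eq_sub_of_hasDerivAt_of_le (a := 0) (b := 1)
    (f := fun t => jmPrim m (γ.extend t) k)
    (f' := fun t => (derivWithin γ.extend (Set.Icc 0 1) t * jmData m (γ.extend t) k).re)
    zero_le_one ?_ ?_ ?_
  · simp only [Path.extend_one, Path.extend_zero] at hg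
    exact hg.symm
  · intro t _
    exact ((hasFDerivAt_jmPrim (hmem t) k).continuousAt.comp
      γ.continuous_extend.continuousAt).continuousWithinAt
  · intro t ht
    have hd := ((hγ t ⟨ht.1.le, ht.2.le⟩).differentiableWithinAt one_ne_zero).hasDerivWithinAt
      |>.hasDerivAt (Icc_mem_nhds ht.1 ht.2)
    exact (hasFDerivAt_jmPrim (hmem t) k).comp_hasDerivAt t hd
  · exact (Complex.continuous_re.comp_continuousOn hcont).intervalIntegrable_of_Icc zero_le_one

end

theorem mainTheorem3 (m : ℕ) (hm : 1 ≤ m) (z₀ : ℂ) (hz₀ : z₀ ^ (m + 1) ≠ 1) :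
    ∃ f : RSphere → EuclideanSpace ℝ (Fin (2 * m + 1)),
      IsJorgeMeeksIntegral m z₀ f ∧
      IsConformalMinimalImmersion f (jmDomain m) ∧
      IsCompleteImmersion f (jmDomain m) ∧
      IsFull f (jmDomain m) ∧
      HasFiniteTotalCurvature f (jmDomain m) ∧
      totalCurvature f (jmDomain m) = -4 * m * Real.pi ∧
      HasNondegenerateGaussMap f (jmDomain m) ∧
      numEnds (jmDomain m) = m + 1 ∧
      ∃ χ : ℤ, HasEulerNumber (jmDomain m) χ ∧
        AttainsChernOsserman f (jmDomain m) χ ∧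
        AttainsEjiri f (jmDomain m) χ 0 := by
  refine ⟨jmSurface m z₀, isJorgeMeeksIntegral_jmSurface m z₀,
    isConformalMinimalImmersion_jmSurface hm z₀, isCompleteImmersion_jmSurface hm z₀,
    isFull_jmSurface hm z₀, hasFiniteTotalCurvature_jmSurface hm z₀,
    totalCurvature_jmSurface hm z₀, hasNondegenerateGaussMap_jmSurface hm z₀,
    -- For l = 0 the whole space is the admissible subspace. With χ = 1 - m, k = m + 1 and n = 2m +
    -- 1, both 2(χ - k) and χ + k - 2n equal -4m.
    numEnds_jmDomain m, 1 - m, hasEulerNumber_jmDomain m, ?_, ⟨⊤, by simp, fun _ _ => le_top⟩, ?_⟩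
  · rw [AttainsChernOsserman, totalCurvature_jmSurface hm z₀, numEnds_jmDomain]
    push_cast
    ring
  · rw [totalCurvature_jmSurface hm z₀, numEnds_jmDomain]
    push_cast
    ring
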